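/- **Setting.** Let $L\ge 2$ and $T\ge 2$ be fixed. Consider a fully connected network with layer widths $M_0,\dots,M_{L-1}$ and $M_L=C\ge1$, where $C$ is fixed and $M_l/M\to\alpha_l>0$ as $M\to\infty$ for $0\le l\le L-1$ (e.g. $M_l=\alpha_l M$). All weights $W^l_{ij}\sim\mathcal N(0,\sigma_w^2/M_{l-1})$ and biases $b^l_i\sim\mathcal N(0,\sigma_b^2)$ ($1\le l\le L$, $\sigma_w>0$, $\sigma_b\ge0$) and all input coordinates $x_j(t)\sim\mathcal N(0,1)$ ($1\le t\le T$, $1\le j\le M_0$) are independent. With $h^0(t)=x(t)$ and $\mathrm E[\cdot]=\frac1T\sum_{t=1}^T$, put, for $1\le l\le L-1$, $$u_i^l(t)=\sum_j W^l_{ij}h^{l-1}_j(t)+b^l_i,\qquad \bar u^l_i(t)=\frac{u^l_i(t)-\mu^l_i}{\sigma^l_i},\qquad h^l_i(t)=\phi_l(\bar u^l_i(t)),$$ $$\mu_i^l=\mathrm E[u_i^l(t)],\qquad \sigma_i^l=\sqrt{\mathrm E[u_i^l(t)^2]-(\mu_i^l)^2},$$ while the last layer is linear and not normalized: $f_k(t)=\sum_jW^L_{kj}h^{L-1}_j(t)+b^L_k$,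 $1\le k\le C$. Let $\theta$ be the vector of all weights and biases, let $F=\sum_{k=1}^C\mathrm E[\nabla_\theta f_k(t)\nabla_\theta f_k(t)^\top]$, and let $\lambda_{max}$ be its largest eigenvalue. Each $\phi_l:\mathbb R\to\mathbb R$ ($1\le l\le L-1$) is continuous, has a bounded weak derivative, and is non-negative. Call $z\in\mathbb R^T$ a *normalized batch* if $\sum_t z_t=0$ and $\sum_t z_t^2=T$. Assume that $\phi_{L-1}(z_t)>0$ for some normalized batch $z$ and some $t$, and that for each $1\le l<L-1$ there are a normalized batch $z$ and $s,t$ with $\phi_l(z_s)\ne\phi_l(z_t)$ (so that the standard deviations $\sigma^{l+1}_i$ do not vanish identically). **Order parameters.** Put $\Sigma_0=I_T$ and, for $1\le l\le L-1$, $$(\Sigma_l)_{st}=\mathbb E_{u\sim\mathcal N(0,\sigma_w^2\Sigma_{l-1})}\left[\phi_l(\bar u_s)\phi_l(\bar u_t)\right],\qquad \bar u_t=\frac{u_t-\frac1T\sum_r u_r}{\sqrt{\frac1T\sum_r u_r^2-\left(\frac1T\sum_r u_r\right)^2}} .$$ **Theorem 3.4.** The matrix $\Sigma_{L-1}$ has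 a constant diagonal entry $\hat q^{L-1}_{t,BN}$ and a constant off-diagonal entry $\hat q^{L-1}_{st,BN}$; these do not depend on $M$, the $\alpha_l$, $C$ or $\sigma_b$. One has $\hat q^{L-1}_{t,BN}>0$ and $\hat q^{L-1}_{st,BN}\ge0$, and also $\hat q^{L-1}_{st,BN}>0$ as soon as $\phi_{L-1}(z_s)>0$ and $\phi_{L-1}(z_t)>0$ for some normalized batch $z$ and some $s\neq t$. For all $s,t$, $$\frac1{M_{L-1}}\sum_i h^{L-1}_i(s)h^{L-1}_i(t)\to(\Sigma_{L-1})_{st}\quad\text{in probability as } M\to\infty .$$ Moreover, for every $\varepsilon>0$, with probability tending to $1$ as $M\to\infty$, $$\lambda_{max}\ \ge\ \left(\alpha_{L-1}\left(\frac{T-1}{T}\,\hat q^{L-1}_{st,BN}+\frac{\hat q^{L-1}_{t,BN}}{T}\right)-\varepsilon\right)M .$$ In particular, there is a constant $c>0$ such that $\lambda_{max}\ge cM$ with probability tending to $1$: $\lambda_{max}$ remains at least of order $M$. -/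

import Mathlib

open MeasureTheory ProbabilityTheory Filter Topology
open scoped NNReal ENNReal

namespace BNNet

noncomputable section

/-- `φ` (represented by its continuous version) has a bounded weak derivative `g` on the line. -/
def HasBoundedWeakDeriv (φ : ℝ → ℝ) : Prop :=
  Continuous φ ∧ ∃ g : ℝ → ℝ, Measurable g ∧ (∃ K : ℝ, ∀ x, |g x| ≤ K) ∧
    ∀ ψ : ℝ → ℝ, ContDiff ℝ (⊤ : ℕ∞) ψ → HasCompactSupport ψ →
      ∫ x, φ x * deriv ψ x = - ∫ x, g x * ψ x

/-! ### Batch statistics -/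

/-- Average over the `T` samples. -/
def batchMean {T : ℕ} (u : Fin T → ℝ) : ℝ := (∑ t, u t) / T

/-- Standard deviation over the `T` samples. -/
def batchStd {T : ℕ} (u : Fin T → ℝ) : ℝ :=
  Real.sqrt (batchMean (fun t => u t ^ 2) - batchMean u ^ 2)

/-- Batch normalization of the pre-activations of one unit (scale `1`, shift `0`). -/
def batchNorm {T : ℕ} (u : Fin T → ℝ) (t : Fin T) : ℝ := (u t - batchMean u) / batchStd u

/-- The possible values of a batch-normalized unit: mean `0` and mean square `1` over the batch. -/
def IsNormalizedBatch {T : ℕ} (z : Fin T → ℝ) : Prop :=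
  ∑ t, z t = 0 ∧ ∑ t, z t ^ 2 = (T : ℝ)

/-! ### The network

There are `H` hidden layers `1, …, H` and the output layer `H + 1`; layer `l` has `n l` units, and
layer `0` is the input. -/

/-- Index set of all trainable parameters. `Sum.inl ⟨l, (i, j)⟩` is the weight from unit `j` of
layer `l` to unit `i` of layer `l + 1`; `Sum.inr ⟨l, i⟩` is the bias of unit `i` of layer
`l + 1`. -/
abbrev ParamIdx (n : ℕ → ℕ) (H : ℕ) : Type :=
  (Σ l : Fin (H + 1), Fin (n (l.val + 1)) × Fin (n l.val)) ⊕
    (Σ l : Fin (H + 1), Fin (n (l.val + 1)))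

/-- Pre-activation of unit `i` of layer `l + 1`, given the outputs `a` of layer `l`. -/
def preAct {n : ℕ → ℕ} {H : ℕ} (θ : ParamIdx n H → ℝ) (l : ℕ) (hl : l < H + 1)
    (a : Fin (n l) → ℝ) (i : Fin (n (l + 1))) : ℝ :=
  (∑ j, θ (Sum.inl ⟨⟨l, hl⟩, (i, j)⟩) * a j) + θ (Sum.inr ⟨⟨l, hl⟩, i⟩)

/-- Output of unit `i` of layer `l ≤ H` on sample `t`; every hidden unit is batch-normalized
before its activation function `φ l` is applied. -/
def hiddenOut {n : ℕ → ℕ} {H T : ℕ} (φ : ℕ → ℝ → ℝ) (θ : ParamIdx n H → ℝ)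
    (x : Fin T → Fin (n 0) → ℝ) : (l : ℕ) → l < H + 1 → Fin T → Fin (n l) → ℝ
  | 0, _ => x
  | l + 1, hl => fun t i =>
      φ (l + 1) (batchNorm (fun s =>
        preAct θ l (Nat.lt_of_succ_lt hl) (hiddenOut φ θ x l (Nat.lt_of_succ_lt hl) s) i) t)

/-- The `k`-th network output on sample `t`; the output layer is linear and not normalized. -/
def netOutput {n : ℕ → ℕ} {H T : ℕ} (φ : ℕ → ℝ → ℝ) (θ : ParamIdx n H → ℝ)
    (x : Fin T → Fin (n 0) → ℝ) (t : Fin T) (k : Fin (n (H + 1))) : ℝ :=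
  preAct θ H (Nat.lt_succ_self H) (hiddenOut φ θ x H (Nat.lt_succ_self H) t) k

/-- Partial derivative of the output `f_k(t)` with respect to the parameter `p`.
(Wherever no batch standard deviation vanishes, the outputs are locally Lipschitz in the parameters,
hence differentiable at Lebesgue-almost every such parameter.) -/
def outputPartial {n : ℕ → ℕ} {H T : ℕ} (φ : ℕ → ℝ → ℝ) (θ : ParamIdx n H → ℝ)
    (x : Fin T → Fin (n 0) → ℝ) (t : Fin T) (k : Fin (n (H + 1))) (p : ParamIdx n H) : ℝ :=
  deriv (fun y : ℝ => netOutput φ (Function.update θ p y) x t k) (θ p)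

/-- The empirical Fisher information matrix
`F = ∑ₖ (1/T) ∑ₜ ∇_θ f_k(t) ∇_θ f_k(t)ᵀ`, over all weights and biases of all layers. -/
def fim {n : ℕ → ℕ} {H T : ℕ} (φ : ℕ → ℝ → ℝ) (θ : ParamIdx n H → ℝ)
    (x : Fin T → Fin (n 0) → ℝ) : Matrix (ParamIdx n H) (ParamIdx n H) ℝ :=
  Matrix.of fun p p' => ∑ k : Fin (n (H + 1)),
    (∑ t : Fin T, outputPartial φ θ x t k p * outputPartial φ θ x t k p') / (T : ℝ)

/-- The largest real eigenvalue of a (symmetric) matrix. -/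
def maxEigenvalue {ι : Type*} [Fintype ι] [DecidableEq ι] (A : Matrix ι ι ℝ) : ℝ :=
  sSup {r : ℝ | Module.End.HasEigenvalue (Matrix.toLin' A) r}

/-- Overlap `(1 / n_l) ∑ᵢ hᵢˡ(s) hᵢˡ(t)` of the layer-`l` outputs on the samples `s` and `t`
in the finite network. -/
def overlap {n : ℕ → ℕ} {H T : ℕ} (φ : ℕ → ℝ → ℝ) (θ : ParamIdx n H → ℝ)
    (x : Fin T → Fin (n 0) → ℝ) (l : ℕ) (hl : l < H + 1) (s t : Fin T) : ℝ :=
  (∑ i, hiddenOut φ θ x l hl s i * hiddenOut φ θ x l hl t i) / (n l : ℝ)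

/-! ### The random ensemble -/

/-- Variance of a parameter: `σ_w² / n_l` for weights leaving layer `l`, `σ_b²` for biases. -/
def paramVar (n : ℕ → ℕ) (H : ℕ) (σw σb : ℝ≥0) : ParamIdx n H → ℝ≥0
  | Sum.inl p => σw ^ 2 / (n p.1.val : ℝ≥0)
  | Sum.inr _ => σb ^ 2

/-- Joint law of the parameters and of the `T` input samples: all of them are independent
centred Gaussians, and the input coordinates are standard. -/
def ensemble (n : ℕ → ℕ) (H T : ℕ) (σw σb : ℝ≥0) :
    Measure ((ParamIdx n H → ℝ) × (Fin T → Fin (n 0) → ℝ)) :=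
  (Measure.pi fun p => gaussianReal 0 (paramVar n H σw σb p)).prod
    (Measure.pi fun _ => Measure.pi fun _ => gaussianReal 0 1)

/-! ### Order parameters -/

/-- Feedforward order parameters of the batch-normalized network, as a `T × T` matrix per layer.
For the inputs it is the identity, and in layer `l + 1` the `(s, t)` entry is the expectation of
`φ(ū(s)) φ(ū(t))`, where `ū` is the batch normalization of `u ∼ N(0, σ_w² Σ_l)`. -/
def orderParam (φ : ℕ → ℝ → ℝ) (σw : ℝ≥0) (T : ℕ) : ℕ → Matrix (Fin T) (Fin T) ℝ
  | 0 => 1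
  | l + 1 => Matrix.of fun s t =>
      ∫ u : EuclideanSpace ℝ (Fin T),
        φ (l + 1) (batchNorm (fun r => u r) s) * φ (l + 1) (batchNorm (fun r => u r) t)
          ∂(multivariateGaussian 0 (((σw : ℝ) ^ 2) • orderParam φ σw T l))

end

end BNNet

namespace BNNet

/-! ### Algebra of batch normalization -/

section Batch

variable {T : ℕ}

/-! The lower bound comes from the output weights alone. The outputs are linear in them, so the
gradient of `f_k(t)` in the weights of unit `k` is the last hidden vector `h(t)`. Test the Fisher
matrix on the vector `w = ∑ₜ h(t)` placed in the weights of one output, and put `N = ‖w‖²`.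
Cauchy–Schwarz over the samples bounds the quadratic form below by `N² / T²`, so the Rayleigh
quotient is at least `N / T²`, the average over `s, t` of `h(s)·h(t)`, i.e. the last width times the
mean overlap (`overlap_le_maxEigenvalue_fim`).

The overlaps concentrate layer by layer (`tendsto_overlap`). With the earlier layers frozen, the
units of a layer are independent functions of Gaussian batches with covariance `σ_w²` times the
previous overlap matrix. The biases are common shifts, which normalization erases. Normalized values
lie in `[-√T, √T]`, so activations are bounded and Chebyshev's inequality applies; it remains to
pass to the limit in the covariance.

For that, normalization must be continuous almost surely at the limit. Each limiting covariance
below the last hidden layer has the form `a I + b J` with `a > 0`, where `J` is the all-ones matrix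
(`exists_orderParam_eq`). Its square root is a dilation plus a common shift, so normalization cannot
distinguish it from the identity (`integral_pairAct_exchangeable`). Every order parameter past the
input is therefore a standard Gaussian mean: permutation symmetry gives constant diagonal and
off-diagonal entries, and full support of the Gaussian gives the strict inequalities. -/

lemma batchVar_eq (hT : 0 < T) (u : Fin T → ℝ) :
    batchMean (fun t => u t ^ 2) - batchMean u ^ 2 = (∑ t, (u t - batchMean u) ^ 2) / T := by
  have hT' : (T : ℝ) ≠ 0 := by positivity
  have h1 : ∑ t, (u t - batchMean u) ^ 2
      = ∑ t, u t ^ 2 - 2 * batchMean u * ∑ t, u t + T * batchMean u ^ 2 := by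
    simp only [sub_sq, Finset.sum_add_distrib, Finset.sum_sub_distrib, Finset.mul_sum,
      Finset.sum_const, Finset.card_univ, Fintype.card_fin, nsmul_eq_mul]
    congr 2
    exact Finset.sum_congr rfl fun t _ => by ring
  have h2 : ∑ t, u t = T * batchMean u := by
    unfold batchMean; field_simp
  rw [h1, h2]
  have h3 : batchMean (fun t => u t ^ 2) = (∑ t, u t ^ 2) / T := rfl
  rw [h3]
  field_simp
  ring

lemma batchStd_eq (hT : 0 < T) (u : Fin T → ℝ) :
    batchStd u = √((∑ t, (u t - batchMean u) ^ 2) / T) := by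
  rw [batchStd, batchVar_eq hT]

lemma sq_sub_batchMean_le (hT : 0 < T) (u : Fin T → ℝ) (t : Fin T) :
    (u t - batchMean u) ^ 2 ≤ T * batchStd u ^ 2 := by
  have hT' : (0 : ℝ) < T := by positivity
  rw [batchStd_eq hT, Real.sq_sqrt (by positivity), mul_div_cancel₀ _ hT'.ne']
  exact Finset.single_le_sum (f := fun t => (u t - batchMean u) ^ 2)
    (fun _ _ => sq_nonneg _) (Finset.mem_univ t)

lemma abs_batchNorm_le (hT : 0 < T) (u : Fin T → ℝ) (t : Fin T) :
    |batchNorm u t| ≤ √T := by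
  -- On a constant batch division by zero makes `batchNorm` vanish, so the bound needs no
  -- nondegeneracy.
  rcases eq_or_ne (batchStd u) 0 with h | h
  · simp [batchNorm, h]
  · refine Real.abs_le_sqrt ?_
    rw [batchNorm, div_pow, div_le_iff₀ (by positivity)]
    exact sq_sub_batchMean_le hT u t

lemma eq_of_batchStd_eq_zero (hT : 0 < T) {u : Fin T → ℝ} (h : batchStd u = 0) (s t : Fin T) :
    u s = u t := by
  have key : ∀ t, u t = batchMean u := fun t => by
    have := sq_sub_batchMean_le hT u t
    rw [h] at this
    have h0 : (u t - batchMean u) ^ 2 = 0 := le_antisymm (by simpa using this) (sq_nonneg _)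
    exact sub_eq_zero.1 (pow_eq_zero_iff (two_ne_zero) |>.1 h0)
  rw [key s, key t]

lemma batchMean_affine (hT : 0 < T) (c k : ℝ) (u : Fin T → ℝ) :
    batchMean (fun t => c * u t + k) = c * batchMean u + k := by
  have hT' : (T : ℝ) ≠ 0 := by positivity
  simp only [batchMean, Finset.sum_add_distrib, ← Finset.mul_sum, Finset.sum_const,
    Finset.card_univ, Fintype.card_fin, nsmul_eq_mul]
  field_simp

lemma batchStd_affine (hT : 0 < T) {c : ℝ} (hc : 0 ≤ c) (k : ℝ) (u : Fin T → ℝ) :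
    batchStd (fun t => c * u t + k) = c * batchStd u := by
  rw [batchStd_eq hT, batchStd_eq hT, batchMean_affine hT]
  have : ∑ t, (c * u t + k - (c * batchMean u + k)) ^ 2
      = c ^ 2 * ∑ t, (u t - batchMean u) ^ 2 := by
    rw [Finset.mul_sum]; exact Finset.sum_congr rfl fun t _ => by ring
  rw [this, mul_div_assoc, Real.sqrt_mul (sq_nonneg c), Real.sqrt_sq hc]

lemma batchNorm_affine (hT : 0 < T) {c : ℝ} (hc : 0 < c) (k : ℝ) (u : Fin T → ℝ) :
    batchNorm (fun t => c * u t + k) = batchNorm u := by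
  funext t
  rw [batchNorm, batchNorm, batchStd_affine hT hc.le, batchMean_affine hT]
  rw [← mul_div_mul_left (u t - batchMean u) _ hc.ne']
  congr 1
  ring

lemma batchNorm_add_const (hT : 0 < T) (k : ℝ) (u : Fin T → ℝ) :
    batchNorm (fun t => u t + k) = batchNorm u := by
  simpa using batchNorm_affine hT one_pos k u

lemma IsNormalizedBatch.batchMean_eq {z : Fin T → ℝ} (hz : IsNormalizedBatch z) :
    batchMean z = 0 := by
  simp [batchMean, hz.1]

lemma IsNormalizedBatch.batchStd_eq (hT : 0 < T) {z : Fin T → ℝ} (hz : IsNormalizedBatch z) :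
    batchStd z = 1 := by
  have hT' : (T : ℝ) ≠ 0 := by positivity
  rw [BNNet.batchStd_eq hT, hz.batchMean_eq]
  simp [hz.2, hT']

lemma IsNormalizedBatch.batchNorm_eq (hT : 0 < T) {z : Fin T → ℝ} (hz : IsNormalizedBatch z) :
    batchNorm z = z := by
  funext t
  simp [batchNorm, hz.batchMean_eq, hz.batchStd_eq hT]

lemma continuous_batchMean : Continuous (batchMean (T := T)) := by
  unfold batchMean; fun_prop

lemma continuous_batchStd : Continuous (batchStd (T := T)) := by
  unfold batchStd batchMean; fun_prop

lemma measurable_batchNorm (t : Fin T) : Measurable fun u : Fin T → ℝ => batchNorm u t := by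
  have h1 := (continuous_batchMean (T := T)).measurable
  have h2 := (continuous_batchStd (T := T)).measurable
  unfold batchNorm
  fun_prop

lemma continuousAt_batchNorm {u : Fin T → ℝ} (h : batchStd u ≠ 0) (t : Fin T) :
    ContinuousAt (fun u : Fin T → ℝ => batchNorm u t) u := by
  unfold batchNorm
  exact ((continuous_apply t).continuousAt.sub continuous_batchMean.continuousAt).div
    continuous_batchStd.continuousAt h

lemma batchNorm_comp_perm (e : Equiv.Perm (Fin T)) (u : Fin T → ℝ) (t : Fin T) :
    batchNorm (fun r => u (e r)) t = batchNorm u (e t) := by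
  have h1 : batchMean (fun r => u (e r)) = batchMean u := by
    simp only [batchMean]; rw [Equiv.sum_comp e u]
  have h2 : batchMean (fun r => u (e r) ^ 2) = batchMean fun r => u r ^ 2 := by
    simp only [batchMean]; rw [Equiv.sum_comp e fun r => u r ^ 2]
  simp only [batchNorm, batchStd, h1, h2]

end Batch

/-! ### Products of activations of a normalized unit -/

section PairAct

variable {T : ℕ}

/-- The product of the activations of a batch-normalized unit on the samples `s` and `t`. -/
noncomputable def pairAct (f : ℝ → ℝ) (s t : Fin T) (u : Fin T → ℝ) : ℝ :=
  f (batchNorm u s) * f (batchNorm u t)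

variable {f : ℝ → ℝ}

lemma measurable_pairAct (hf : Continuous f) (s t : Fin T) : Measurable (pairAct f s t) :=
  (hf.measurable.comp (measurable_batchNorm s)).mul (hf.measurable.comp (measurable_batchNorm t))

lemma continuousAt_pairAct (hf : Continuous f) (s t : Fin T) {u : Fin T → ℝ}
    (h : batchStd u ≠ 0) : ContinuousAt (pairAct f s t) u :=
  (hf.continuousAt.comp (continuousAt_batchNorm h s)).mul
    (hf.continuousAt.comp (continuousAt_batchNorm h t))

lemma pairAct_affine (hT : 0 < T) {c : ℝ} (hc : 0 < c) (k : ℝ) (s t : Fin T) (u : Fin T → ℝ) :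
    pairAct f s t (fun r => c * u r + k) = pairAct f s t u := by
  simp [pairAct, batchNorm_affine hT hc]

/-- Only the values of `f` on the compact interval `[-√T, √T]` matter. The bound supplies both the
variance estimate and the dominating function below. -/
lemma exists_abs_pairAct_le (hT : 0 < T) (hf : Continuous f) :
    ∃ B : ℝ, ∀ (s t : Fin T) (u : Fin T → ℝ), |pairAct f s t u| ≤ B := by
  obtain ⟨K, hK⟩ := (isCompact_Icc (a := -√(T : ℝ)) (b := √T)).exists_bound_of_continuousOn
    hf.continuousOn
  refine ⟨K * K, fun s t u => ?_⟩
  have h (t : Fin T) : |f (batchNorm u t)| ≤ K := hK _ (abs_le.1 (abs_batchNorm_le hT u t))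
  rw [pairAct, abs_mul]
  exact mul_le_mul (h s) (h t) (abs_nonneg _) ((abs_nonneg _).trans (h s))

end PairAct

/-! ### Gaussian batches -/

section Gaussian

variable {T : ℕ}

instance isOpenPosMeasure_stdGaussian :
    (stdGaussian (EuclideanSpace ℝ (Fin T))).IsOpenPosMeasure := by
  rw [← map_pi_eq_stdGaussian]
  have : (gaussianReal 0 1).IsOpenPosMeasure :=
    (gaussianReal_absolutelyContinuous' 0 one_ne_zero).isOpenPosMeasure
  exact (PiLp.continuous_toLp 2 _).isOpenPosMeasure_map (WithLp.toLp_surjective 2)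

/-- The difference of two coordinates is a nondegenerate real Gaussian, which has no atom at `0`. -/
lemma ae_stdGaussian_apply_ne {s t : Fin T} (hst : s ≠ t) :
    ∀ᵐ u ∂stdGaussian (EuclideanSpace ℝ (Fin T)), u s ≠ u t := by
  set L : StrongDual ℝ (EuclideanSpace ℝ (Fin T)) :=
    EuclideanSpace.proj s - EuclideanSpace.proj t with hL
  have hL0 : L ≠ 0 := fun h => by
    have := congrArg (fun l : StrongDual ℝ (EuclideanSpace ℝ (Fin T)) =>
      l (EuclideanSpace.single s 1)) h
    simp [hL, hst.symm] at this
  have hmap := IsGaussian.map_eq_gaussianReal (μ := stdGaussian (EuclideanSpace ℝ (Fin T))) L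
  have hv : Var[L; stdGaussian (EuclideanSpace ℝ (Fin T))].toNNReal ≠ 0 := by
    rw [variance_dual_stdGaussian]
    have : 0 < ‖L‖ := norm_pos_iff.2 hL0
    exact (Real.toNNReal_pos.2 (by positivity)).ne'
  have hatom := nullSingletonClass_gaussianReal (μ := ∫ x, L x ∂stdGaussian _) hv
  have h0 : (stdGaussian (EuclideanSpace ℝ (Fin T))).map L {0} = 0 := by
    rw [hmap]; exact measure_singleton 0
  rw [Measure.map_apply (by fun_prop) (measurableSet_singleton 0)] at h0
  refine measure_mono_null (fun u hu => ?_) h0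
  have hu' : u s = u t := not_not.1 hu
  simp [hL, hu']

lemma ae_stdGaussian_batchStd_ne_zero (hT : 2 ≤ T) :
    ∀ᵐ u ∂stdGaussian (EuclideanSpace ℝ (Fin T)), batchStd (fun r => u r) ≠ 0 := by
  have hne : (⟨0, by omega⟩ : Fin T) ≠ ⟨1, by omega⟩ := by simp
  filter_upwards [ae_stdGaussian_apply_ne hne] with u hu h
  exact hu (eq_of_batchStd_eq_zero (by omega) h _ _)

open scoped MatrixOrder in
/-- The square root of a matrix with constant diagonal and constant off-diagonal entries acts on a
batch as a dilation followed by a common shift. -/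
lemma toEuclideanCLM_sqrt_exchangeable (hT : 0 < T) {a b : ℝ} (ha : 0 ≤ a) (hb : 0 ≤ b)
    {S : Matrix (Fin T) (Fin T) ℝ} (hS : ∀ s t, S s t = (if s = t then a else 0) + b)
    (x : EuclideanSpace ℝ (Fin T)) :
    (fun r => Matrix.toEuclideanCLM (𝕜 := ℝ) (CFC.sqrt S) x r)
      = fun r => √a * x r + (√(a + b * T) - √a) / T * ∑ t, x t := by
  have hT' : (0 : ℝ) < T := by positivity
  -- The eigenvalues of `S` are `a` on sum-zero vectors and `a + b T` on constants; this `d` gives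
  -- `R` their square roots as eigenvalues.
  set d : ℝ := (√(a + b * T) - √a) / T with hd
  have hd0 : 0 ≤ d := div_nonneg (sub_nonneg.2 (Real.sqrt_le_sqrt (by nlinarith))) hT'.le
  set R : Matrix (Fin T) (Fin T) ℝ := √a • 1 + d • Matrix.of fun _ _ => 1 with hR
  have hRR : R * R = S := by
    have hJ : (Matrix.of fun _ _ => (1 : ℝ) : Matrix (Fin T) (Fin T) ℝ) * (Matrix.of fun _ _ => 1)
        = (T : ℝ) • Matrix.of fun _ _ => 1 := by
      ext i j; simp [Matrix.mul_apply]
    have : R * R = a • 1 + b • Matrix.of fun _ _ => 1 := by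
      rw [hR]
      have hsplit : (√a • 1 + d • Matrix.of fun _ _ => 1 : Matrix (Fin T) (Fin T) ℝ)
          * (√a • 1 + d • Matrix.of fun _ _ => 1)
          = (√a * √a) • 1 + (√a * d + √a * d + d * d * T) • Matrix.of fun _ _ => 1 := by
        simp only [add_mul, mul_add, smul_mul_assoc, mul_smul_comm, one_mul, mul_one, hJ]
        module
      rw [hsplit, Real.mul_self_sqrt ha]
      congr 2
      have h1 : (√(a + b * T)) ^ 2 = a + b * T := Real.sq_sqrt (by positivity)
      have h2 : (√a) ^ 2 = a := Real.sq_sqrt ha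
      rw [hd]
      field_simp
      nlinarith
    rw [this]
    ext s t
    simp [hS, Matrix.one_apply]
  have hRpos : R.PosSemidef := by
    refine (Matrix.PosSemidef.one.smul (Real.sqrt_nonneg a)).add (Matrix.PosSemidef.smul ?_ hd0)
    have h := Matrix.posSemidef_vecMulVec_self_star (fun _ : Fin T => (1 : ℝ))
    convert h using 1
    ext i j
    simp [Matrix.vecMulVec_apply]
  have hsqrt : CFC.sqrt S = R := CFC.sqrt_unique hRR hRpos.nonneg
  funext r
  rw [hsqrt, hR]
  simp [Matrix.ofLp_toEuclideanCLM, Matrix.mulVec, dotProduct, Finset.mul_sum]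

lemma integral_pairAct_exchangeable (hT : 0 < T) {f : ℝ → ℝ} (hf : Continuous f) {a b : ℝ}
    (ha : 0 < a) (hb : 0 ≤ b) {S : Matrix (Fin T) (Fin T) ℝ}
    (hS : ∀ s t, S s t = (if s = t then a else 0) + b) (s t : Fin T) :
    ∫ u : EuclideanSpace ℝ (Fin T), pairAct f s t (fun r => u r) ∂(multivariateGaussian 0 S)
      = ∫ u : EuclideanSpace ℝ (Fin T), pairAct f s t (fun r => u r) ∂(stdGaussian _) := by
  have hm : Measurable fun u : EuclideanSpace ℝ (Fin T) => pairAct f s t (fun r => u r) :=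
    (measurable_pairAct hf s t).comp (by fun_prop)
  rw [multivariateGaussian, integral_map (by fun_prop) hm.aestronglyMeasurable]
  refine integral_congr_ae (ae_of_all _ fun x => ?_)
  have := toEuclideanCLM_sqrt_exchangeable hT ha.le hb hS x
  simp only [zero_add]
  rw [this, pairAct_affine hT (Real.sqrt_pos.2 ha)]

open scoped MatrixOrder Matrix.Norms.L2Operator in
lemma continuousOn_matrix_sqrt :
    ContinuousOn (CFC.sqrt : Matrix (Fin T) (Fin T) ℝ → _) {S | S.PosSemidef} := by
  have h := CFC.continuousOn_sqrt (A := Matrix (Fin T) (Fin T) ℝ)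
  refine h.mono fun S hS => ?_
  exact Matrix.PosSemidef.nonneg hS

open scoped MatrixOrder in
-- Writing each Gaussian as the image of one standard Gaussian under the matrix square root turns
-- this into dominated convergence. The square root is continuous on positive semidefinite matrices,
-- and since `a > 0` the limiting batch is almost surely nonconstant, hence a continuity point of
-- normalization.
lemma tendsto_integral_pairAct (hT : 2 ≤ T) {f : ℝ → ℝ} (hf : Continuous f) {a b : ℝ}
    (ha : 0 < a) (hb : 0 ≤ b) {S : Matrix (Fin T) (Fin T) ℝ}
    (hS : ∀ s t, S s t = (if s = t then a else 0) + b) (hSp : S.PosSemidef) (s t : Fin T) :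
    Tendsto (fun K : Matrix (Fin T) (Fin T) ℝ =>
        ∫ u : EuclideanSpace ℝ (Fin T), pairAct f s t (fun r => u r) ∂(multivariateGaussian 0 K))
      (𝓝[{K | K.PosSemidef}] S)
      (𝓝 (∫ u : EuclideanSpace ℝ (Fin T), pairAct f s t (fun r => u r)
        ∂(multivariateGaussian 0 S))) := by
  have hT0 : 0 < T := by omega
  have : FirstCountableTopology (Matrix (Fin T) (Fin T) ℝ) :=
    inferInstanceAs (FirstCountableTopology (Fin T → Fin T → ℝ))
  have hm : Measurable fun u : EuclideanSpace ℝ (Fin T) => pairAct f s t (fun r => u r) :=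
    (measurable_pairAct hf s t).comp (by fun_prop)
  obtain ⟨B, hB⟩ := exists_abs_pairAct_le hT0 hf
  have hrw (K : Matrix (Fin T) (Fin T) ℝ) :
      ∫ u : EuclideanSpace ℝ (Fin T), pairAct f s t (fun r => u r) ∂(multivariateGaussian 0 K)
        = ∫ x : EuclideanSpace ℝ (Fin T),
            pairAct f s t (fun r => Matrix.toEuclideanCLM (𝕜 := ℝ) (CFC.sqrt K) x r)
            ∂(stdGaussian _) := by
    rw [multivariateGaussian, integral_map (by fun_prop) hm.aestronglyMeasurable]
    simp
  simp only [hrw]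
  refine tendsto_integral_filter_of_dominated_convergence (fun _ => B) ?_ ?_
    (integrable_const B) ?_
  · exact .of_forall fun K => Measurable.aestronglyMeasurable
      ((measurable_pairAct hf s t).comp (by fun_prop))
  · exact .of_forall fun K => ae_of_all _ fun x => hB s t _
  · filter_upwards [ae_stdGaussian_batchStd_ne_zero hT] with x hx
    have hc : ContinuousAt (pairAct f s t)
        (fun r => Matrix.toEuclideanCLM (𝕜 := ℝ) (CFC.sqrt S) x r) := by
      refine continuousAt_pairAct hf s t ?_
      rw [toEuclideanCLM_sqrt_exchangeable hT0 ha.le hb hS x,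
        batchStd_affine hT0 (Real.sqrt_nonneg a)]
      exact mul_ne_zero (Real.sqrt_pos.2 ha).ne' hx
    refine hc.tendsto.comp (tendsto_pi_nhds.2 fun r => ?_)
    have hsq : Tendsto (CFC.sqrt : Matrix (Fin T) (Fin T) ℝ → _) (𝓝[{K | K.PosSemidef}] S)
        (𝓝 (CFC.sqrt S)) := continuousOn_matrix_sqrt S hSp
    simp only [Matrix.ofLp_toEuclideanCLM]
    have hcont : Continuous fun R : Matrix (Fin T) (Fin T) ℝ => R.mulVec x.ofLp r := by
      fun_prop
    exact (hcont.tendsto _).comp hsq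

lemma integrable_pairAct (hT : 0 < T) {f : ℝ → ℝ} (hf : Continuous f) (s t : Fin T) :
    Integrable (fun u : EuclideanSpace ℝ (Fin T) => pairAct f s t (fun r => u r))
      (stdGaussian _) := by
  obtain ⟨B, hB⟩ := exists_abs_pairAct_le hT hf
  exact .of_bound ((measurable_pairAct hf s t).comp (by fun_prop)).aestronglyMeasurable B
    (ae_of_all _ fun u => hB s t _)

/-- Permuting coordinates is an isometry, which preserves the standard Gaussian, and normalization
commutes with it. -/
lemma integral_pairAct_perm (f : ℝ → ℝ) (e : Equiv.Perm (Fin T)) (s t : Fin T) :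
    ∫ u : EuclideanSpace ℝ (Fin T), pairAct f (e s) (e t) (fun r => u r) ∂(stdGaussian _)
      = ∫ u : EuclideanSpace ℝ (Fin T), pairAct f s t (fun r => u r) ∂(stdGaussian _) := by
  set L := LinearIsometryEquiv.piLpCongrLeft 2 ℝ ℝ e.symm with hL
  have hmp : MeasurePreserving L (stdGaussian (EuclideanSpace ℝ (Fin T)))
      (stdGaussian (EuclideanSpace ℝ (Fin T))) := ⟨by fun_prop, stdGaussian_map L⟩
  have hemb : MeasurableEmbedding L := L.toHomeomorph.measurableEmbedding
  rw [← hmp.integral_comp hemb fun u => pairAct f s t (fun r => u r)]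
  refine integral_congr_ae (ae_of_all _ fun u => ?_)
  have : (fun r => L u r) = fun r => u (e r) := by
    funext r
    simp [hL, LinearIsometryEquiv.piLpCongrLeft_apply, Equiv.piCongrLeft']
  simp only [this, pairAct, batchNorm_comp_perm e (fun r => u r)]

/-- A nonnegative function of the batch which is continuous and positive at a normalized batch has
positive Gaussian mean. -/
lemma integral_stdGaussian_pos {F : (Fin T → ℝ) → ℝ} (hF0 : ∀ u, 0 ≤ F u)
    (hFi : Integrable (fun u : EuclideanSpace ℝ (Fin T) => F (fun r => u r)) (stdGaussian _))
    {z : Fin T → ℝ} (hc : ContinuousAt F z) (hz : 0 < F z) :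
    0 < ∫ u : EuclideanSpace ℝ (Fin T), F (fun r => u r) ∂(stdGaussian _) := by
  rw [integral_pos_iff_support_of_nonneg (fun u => hF0 _) hFi]
  have hcont : Continuous fun u : EuclideanSpace ℝ (Fin T) => (fun r => u r : Fin T → ℝ) := by
    fun_prop
  have hmem : {u : EuclideanSpace ℝ (Fin T) | 0 < F (fun r => u r)} ∈ 𝓝 (WithLp.toLp 2 z) :=
    hcont.continuousAt.preimage_mem_nhds (hc.eventually (lt_mem_nhds hz))
  refine (Measure.measure_pos_of_mem_nhds _ hmem).trans_le (measure_mono fun u hu => ?_)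
  exact (ne_of_gt hu)

variable {f : ℝ → ℝ}

lemma integral_pairAct_nonneg (hf0 : ∀ x, 0 ≤ f x) (s t : Fin T) :
    0 ≤ ∫ u : EuclideanSpace ℝ (Fin T), pairAct f s t (fun r => u r) ∂(stdGaussian _) :=
  integral_nonneg fun _ => mul_nonneg (hf0 _) (hf0 _)

lemma integral_pairAct_pos (hT : 0 < T) (hf : Continuous f) (hf0 : ∀ x, 0 ≤ f x)
    {z : Fin T → ℝ} (hz : IsNormalizedBatch z) {s t : Fin T} (hs : 0 < f (z s))
    (ht : 0 < f (z t)) :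
    0 < ∫ u : EuclideanSpace ℝ (Fin T), pairAct f s t (fun r => u r) ∂(stdGaussian _) := by
  refine integral_stdGaussian_pos (z := z) (fun u => mul_nonneg (hf0 _) (hf0 _))
    (integrable_pairAct hT hf s t) (continuousAt_pairAct hf s t ?_) ?_
  · simp [hz.batchStd_eq hT]
  · rw [pairAct, hz.batchNorm_eq hT]
    exact mul_pos hs ht

lemma exists_perm_pair {s t s' t' : Fin T} (h : s ≠ t) (h' : s' ≠ t') :
    ∃ e : Equiv.Perm (Fin T), e s = s' ∧ e t = t' := by
  refine ⟨(Equiv.swap s s').trans (Equiv.swap (Equiv.swap s s' t) t'), ?_, by simp⟩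
  have h1 : Equiv.swap s s' s = s' := Equiv.swap_apply_left _ _
  have h2 : Equiv.swap s s' t ≠ s' := fun h3 =>
    h ((Equiv.swap s s').injective (h1.trans h3.symm))
  simp only [Equiv.trans_apply, h1]
  exact Equiv.swap_apply_of_ne_of_ne h2.symm h'

/-- The matrix of Gaussian means of `pairAct` is exchangeable. -/
lemma exists_integral_pairAct_eq (hT : 2 ≤ T) (f : ℝ → ℝ) :
    ∃ q r : ℝ, ∀ s t : Fin T,
      ∫ u : EuclideanSpace ℝ (Fin T), pairAct f s t (fun r => u r) ∂(stdGaussian _)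
        = if s = t then q else r := by
  set i : Fin T := ⟨0, by omega⟩
  set j : Fin T := ⟨1, by omega⟩
  have hij : i ≠ j := by simp [i, j]
  refine ⟨∫ u : EuclideanSpace ℝ (Fin T), pairAct f i i (fun r => u r) ∂(stdGaussian _),
    ∫ u : EuclideanSpace ℝ (Fin T), pairAct f i j (fun r => u r) ∂(stdGaussian _), fun s t => ?_⟩
  split_ifs with h
  · subst h
    simpa using integral_pairAct_perm f (Equiv.swap i s) i i
  · obtain ⟨e, rfl, rfl⟩ := exists_perm_pair hij h
    exact integral_pairAct_perm f e i j

/-- Strict positive definiteness of the matrix of Gaussian means of `pairAct`. -/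
lemma integral_pairAct_off_lt_diag (hT : 0 < T) (hf : Continuous f) {z : Fin T → ℝ}
    (hz : IsNormalizedBatch z) {s t : Fin T} (hst : f (z s) ≠ f (z t)) {q r : ℝ}
    (hqr : ∀ s t : Fin T,
      ∫ u : EuclideanSpace ℝ (Fin T), pairAct f s t (fun r => u r) ∂(stdGaussian _)
        = if s = t then q else r) :
    r < q := by
  have hne : s ≠ t := fun h => hst (by rw [h])
  have hi := integrable_pairAct hT hf
  -- The squared difference of the two activations: its mean is `2 (q - r)`, and it is positive at
  -- `z`.
  set F : (Fin T → ℝ) → ℝ := fun v => pairAct f s s v + pairAct f t t v - 2 * pairAct f s t v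
    with hF
  have hsq (v : Fin T → ℝ) : F v = (f (batchNorm v s) - f (batchNorm v t)) ^ 2 := by
    simp only [hF, pairAct]; ring
  have hpos : 0 < ∫ u : EuclideanSpace ℝ (Fin T), F (fun r => u r) ∂(stdGaussian _) := by
    have hstd : batchStd z ≠ 0 := by simp [hz.batchStd_eq hT]
    refine integral_stdGaussian_pos (z := z) (fun u => by rw [hsq]; positivity)
      (((hi s s).add (hi t t)).sub ((hi s t).const_mul 2))
      (((continuousAt_pairAct hf s s hstd).add (continuousAt_pairAct hf t t hstd)).sub
        ((continuousAt_pairAct hf s t hstd).const_mul 2)) ?_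
    rw [hsq, hz.batchNorm_eq hT]
    have := sub_ne_zero.2 hst
    positivity
  have hint : ∫ u : EuclideanSpace ℝ (Fin T), F (fun r => u r) ∂(stdGaussian _)
      = q + q - 2 * r := by
    have h1 := integral_sub ((hi s s).add (hi t t)) ((hi s t).const_mul 2)
    have h2 := integral_add (hi s s) (hi t t)
    simp only [integral_const_mul, hqr, if_true, if_neg hne] at h1 h2
    rw [← h2]
    exact h1
  linarith

end Gaussian

/-! ### The order parameters -/

section OrderParam

variable {H T : ℕ} {σw : ℝ≥0} {φ : ℕ → ℝ → ℝ}

lemma orderParam_succ_apply (l : ℕ) (s t : Fin T) :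
    orderParam φ σw T (l + 1) s t
      = ∫ u : EuclideanSpace ℝ (Fin T), pairAct (φ (l + 1)) s t (fun r => u r)
          ∂(multivariateGaussian 0 (((σw : ℝ) ^ 2) • orderParam φ σw T l)) := rfl

lemma orderParam_succ_eq (hT : 0 < T) (hσw : 0 < σw) {l : ℕ} (hφ : Continuous (φ (l + 1)))
    {a b : ℝ} (ha : 0 < a) (hb : 0 ≤ b)
    (hS : ∀ s t, orderParam φ σw T l s t = (if s = t then a else 0) + b) (s t : Fin T) :
    orderParam φ σw T (l + 1) s t
      = ∫ u : EuclideanSpace ℝ (Fin T), pairAct (φ (l + 1)) s t (fun r => u r)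
          ∂(stdGaussian _) := by
  have hσ : (0 : ℝ) < (σw : ℝ) ^ 2 := by positivity
  rw [orderParam_succ_apply]
  refine integral_pairAct_exchangeable hT hφ (a := (σw : ℝ) ^ 2 * a) (b := (σw : ℝ) ^ 2 * b)
    (by positivity) (by positivity) (fun s t => ?_) s t
  simp [hS, mul_add]

/-- The invariant that keeps the next normalization nondegenerate. Positivity of `a = q - r` comes
from the nonconstancy of `φ l` on some normalized batch, which is assumed only for `l < H`;
nonnegative activations give `b ≥ 0`. -/
lemma exists_orderParam_eq (hT : 2 ≤ T) (hσw : 0 < σw)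
    (hφ : ∀ l, 1 ≤ l → l ≤ H → Continuous (φ l))
    (hφ_nonneg : ∀ l, 1 ≤ l → l ≤ H → ∀ x, 0 ≤ φ l x)
    (hφ_nonconst : ∀ l, 1 ≤ l → l < H →
      ∃ z : Fin T → ℝ, IsNormalizedBatch z ∧ ∃ s t, φ l (z s) ≠ φ l (z t)) :
    ∀ l, l < H → ∃ a b : ℝ, 0 < a ∧ 0 ≤ b ∧
      ∀ s t, orderParam φ σw T l s t = (if s = t then a else 0) + b := by
  intro l
  induction l with
  | zero =>
    intro _
    refine ⟨1, 0, one_pos, le_rfl, fun s t => ?_⟩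
    simp [orderParam, Matrix.one_apply]
  | succ l ih =>
    intro hl
    obtain ⟨a, b, ha, hb, hS⟩ := ih (by omega)
    have hc := hφ (l + 1) (by omega) hl.le
    have heq := orderParam_succ_eq (by omega) hσw hc ha hb hS
    obtain ⟨q, r, hqr⟩ := exists_integral_pairAct_eq hT (φ (l + 1))
    obtain ⟨z, hz, s, t, hst⟩ := hφ_nonconst (l + 1) (by omega) hl
    have hlt := integral_pairAct_off_lt_diag (by omega) hc hz hst hqr
    have hne : s ≠ t := fun h => hst (by rw [h])
    refine ⟨q - r, r, by linarith, ?_, fun s t => ?_⟩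
    · have := integral_pairAct_nonneg (hφ_nonneg (l + 1) (by omega) hl.le) s t
      rwa [hqr, if_neg hne] at this
    · rw [heq, hqr]
      split_ifs <;> ring

lemma posSemidef_of_exchangeable {a b : ℝ} (ha : 0 ≤ a) (hb : 0 ≤ b)
    {S : Matrix (Fin T) (Fin T) ℝ} (hS : ∀ s t, S s t = (if s = t then a else 0) + b) :
    S.PosSemidef := by
  have h : S = a • 1 + b • Matrix.vecMulVec (fun _ => (1 : ℝ)) (star fun _ => 1) := by
    ext s t
    simp [hS, Matrix.one_apply, Matrix.vecMulVec_apply]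
  rw [h]
  exact (Matrix.PosSemidef.one.smul ha).add
    ((Matrix.posSemidef_vecMulVec_self_star _).smul hb)

end OrderParam

/-! ### Product measures -/

section ProductMeasure

variable {ι ι' : Type*} [Fintype ι] [Fintype ι'] {X : Type*} [MeasurableSpace X]

lemma map_pi_comp_injective (μ : ι → Measure X) [∀ i, IsProbabilityMeasure (μ i)] {e : ι' → ι}
    (he : Function.Injective e) :
    (Measure.pi μ).map (fun ω j => ω (e j)) = Measure.pi fun j => μ (e j) := by
  have h : iIndepFun (fun (i : ι) (ω : ι → X) => ω i) (Measure.pi μ) :=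
    iIndepFun_pi (X := fun _ x => x) fun i => aemeasurable_id
  have h' := h.precomp he
  rw [iIndepFun_iff_map_fun_eq_pi_map fun i => (measurable_pi_apply _).aemeasurable] at h'
  rw [h']
  congr 1
  funext j
  exact (measurePreserving_eval μ (e j)).map_eq

/-- Functions of disjoint sets of coordinates are independent. -/
lemma indepFun_pi_of_disjoint (μ : ι → Measure X) [∀ i, IsProbabilityMeasure (μ i)]
    {κ κ' : Type*} [Fintype κ] [Fintype κ'] {e : κ → ι} {e' : κ' → ι} (h : ∀ j j', e j ≠ e' j')
    {Y Y' : Type*} [MeasurableSpace Y] [MeasurableSpace Y'] {g : (κ → X) → Y} {g' : (κ' → X) → Y'}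
    (hg : Measurable g) (hg' : Measurable g') :
    IndepFun (fun ω : ι → X => g fun j => ω (e j)) (fun ω => g' fun j => ω (e' j))
      (Measure.pi μ) := by
  classical
  have hi : iIndepFun (fun (i : ι) (ω : ι → X) => ω i) (Measure.pi μ) :=
    iIndepFun_pi (X := fun _ x => x) fun i => aemeasurable_id
  have hd : Disjoint (Finset.univ.image e) (Finset.univ.image e') := by
    rw [Finset.disjoint_left]
    intro i h1 h2
    obtain ⟨j, -, rfl⟩ := Finset.mem_image.1 h1
    obtain ⟨j', -, hj⟩ := Finset.mem_image.1 h2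
    exact h j j' hj.symm
  have hs := hi.indepFun_finset _ _ hd fun i => measurable_pi_apply i
  exact hs.comp
    (φ := fun w => g fun j => w ⟨e j, Finset.mem_image_of_mem e (Finset.mem_univ j)⟩)
    (ψ := fun w => g' fun j => w ⟨e' j, Finset.mem_image_of_mem e' (Finset.mem_univ j)⟩)
    (hg.comp (by fun_prop)) (hg'.comp (by fun_prop))

/-- Resampling the coordinates in `S` does not change a product law. -/
lemma map_piecewise_pi (μ : ι → Measure X) [∀ i, IsProbabilityMeasure (μ i)] (S : Set ι)
    [∀ i, Decidable (i ∈ S)] :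
    ((Measure.pi μ).prod (Measure.pi μ)).map (fun p => S.piecewise p.2 p.1) = Measure.pi μ := by
  have hm : Measurable fun p : (ι → X) × (ι → X) => S.piecewise p.2 p.1 := by
    refine measurable_pi_iff.2 fun i => ?_
    by_cases hi : i ∈ S
    · simp only [Set.piecewise, hi, if_true]; fun_prop
    · simp only [Set.piecewise, hi, if_false]; fun_prop
  refine (Measure.pi_eq fun s hs => ?_).symm
  rw [Measure.map_apply hm (MeasurableSet.univ_pi hs)]
  have hpre : (fun p : (ι → X) × (ι → X) => S.piecewise p.2 p.1) ⁻¹' Set.univ.pi s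
      = (Set.univ.pi fun i => if i ∈ S then Set.univ else s i)
        ×ˢ (Set.univ.pi fun i => if i ∈ S then s i else Set.univ) := by
    ext p
    simp only [Set.mem_preimage, Set.mem_univ_pi, Set.mem_prod, ← forall_and]
    refine forall_congr' fun i => ?_
    by_cases hi : i ∈ S <;> simp [Set.piecewise, hi]
  rw [hpre, Measure.prod_prod, Measure.pi_pi, Measure.pi_pi, ← Finset.prod_mul_distrib]
  refine Finset.prod_congr rfl fun i _ => ?_
  by_cases hi : i ∈ S <;> simp [hi]

end ProductMeasure

/-- Chebyshev's inequality for averages of pairwise independent variables. -/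
lemma measure_average_le {Ω : Type*} [MeasurableSpace Ω] {μ : Measure Ω} [IsProbabilityMeasure μ]
    {n : ℕ} (hn : 0 < n) {Z : Fin n → Ω → ℝ} (hZ : ∀ i, MemLp (Z i) 2 μ)
    (hind : ∀ i j, i ≠ j → IndepFun (Z i) (Z j) μ) {m V : ℝ} (hm : ∀ i, ∫ ω, Z i ω ∂μ = m)
    (hV : ∀ i, ∫ ω, Z i ω ^ 2 ∂μ ≤ V) {ε : ℝ} (hε : 0 < ε) :
    μ {ω | ε ≤ |(∑ i, Z i ω) / n - m|} ≤ ENNReal.ofReal (V / (n * ε ^ 2)) := by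
  have hn' : (0 : ℝ) < n := by positivity
  have hmem : MemLp (∑ i, Z i) 2 μ := memLp_finsetSum' _ fun i _ => hZ i
  have hmean : ∫ ω, (∑ i, Z i) ω ∂μ = n * m := by
    simp only [Finset.sum_apply]
    rw [integral_finsetSum _ fun i _ => (hZ i).integrable one_le_two]
    simp [hm]
  have hvar : Var[∑ i, Z i; μ] ≤ n * V := by
    rw [IndepFun.variance_sum (fun i _ => hZ i) fun i _ j _ h => hind i j h]
    calc ∑ i, Var[Z i; μ] ≤ ∑ _i : Fin n, V := Finset.sum_le_sum fun i _ =>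
          (variance_le_expectation_sq (hZ i).1).trans (hV i)
      _ = n * V := by simp
  have hset : {ω | ε ≤ |(∑ i, Z i ω) / n - m|}
      = {ω | n * ε ≤ |(∑ i, Z i) ω - ∫ x, (∑ i, Z i) x ∂μ|} := by
    ext ω
    rw [Set.mem_ofPred_eq, Set.mem_ofPred_eq, hmean, Finset.sum_apply]
    have : (∑ i, Z i ω) - n * m = n * ((∑ i, Z i ω) / n - m) := by field_simp
    rw [this, abs_mul, abs_of_pos hn', mul_le_mul_iff_right₀ hn']
  rw [hset]
  refine (meas_ge_le_variance_div_sq hmem (by positivity)).trans (ENNReal.ofReal_le_ofReal ?_)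
  calc Var[∑ i, Z i; μ] / (n * ε) ^ 2 ≤ n * V / (n * ε) ^ 2 := by gcongr
    _ = V / (n * ε ^ 2) := by field_simp

/-! ### One random layer acting on a fixed batch -/

section Layer

variable {n : ℕ → ℕ} {H T : ℕ} {σw σb : ℝ≥0} {f : ℝ → ℝ}

/-- The matrix of overlaps of a batch of vectors. -/
noncomputable def overlapMatrix {m : ℕ} (A : Fin T → Fin m → ℝ) : Matrix (Fin T) (Fin T) ℝ :=
  Matrix.of fun s t => (∑ j, A s j * A t j) / m

lemma posSemidef_gram {m : ℕ} (A : Fin T → Fin m → ℝ) {c : ℝ} (hc : 0 ≤ c) :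
    (c • Matrix.of fun s t => ∑ j, A s j * A t j).PosSemidef := by
  have h := Matrix.posSemidef_self_mul_conjTranspose (Matrix.of A)
  convert h.smul hc using 2
  ext s t
  simp [Matrix.mul_apply]

lemma posSemidef_overlapMatrix {m : ℕ} (A : Fin T → Fin m → ℝ) {c : ℝ} (hc : 0 ≤ c) :
    (c • overlapMatrix A).PosSemidef := by
  convert posSemidef_gram A (c := c / m) (by positivity) using 1
  ext s t
  simp only [overlapMatrix, Matrix.smul_apply, Matrix.of_apply, smul_eq_mul]
  ring

/-- A Gaussian linear form evaluated on a batch is a Gaussian vector whose covariance is the Gram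
matrix of the batch. -/
lemma map_pi_gaussianReal_linear {m : ℕ} (v : ℝ≥0) (A : Fin T → Fin m → ℝ) :
    (Measure.pi fun _ : Fin m => gaussianReal 0 v).map
        (fun w => WithLp.toLp 2 fun s => ∑ j, w j * A s j)
      = multivariateGaussian 0 ((v : ℝ) • Matrix.of fun s t => ∑ j, A s j * A t j) := by
  have hm : Measurable fun w : Fin m → ℝ =>
      (WithLp.toLp 2 fun s => ∑ j, w j * A s j : EuclideanSpace ℝ (Fin T)) := by fun_prop
  have := Measure.isProbabilityMeasure_map (μ := Measure.pi fun _ : Fin m => gaussianReal 0 v)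
    hm.aemeasurable
  -- Pairing the image with `t` is pairing `w` with `c = Aᵀ t`, so both characteristic functions
  -- equal `exp (-v ‖c‖² / 2)`.
  refine Measure.ext_of_charFun (E := EuclideanSpace ℝ (Fin T)) (funext fun t => ?_)
  rw [charFun_multivariateGaussian (posSemidef_gram A v.coe_nonneg), charFun_apply,
    integral_map hm.aemeasurable (Measurable.aestronglyMeasurable (by fun_prop))]
  set c : EuclideanSpace ℝ (Fin m) := WithLp.toLp 2 fun j => ∑ s, A s j * t s with hc
  have h1 (w : Fin m → ℝ) :
      inner ℝ (WithLp.toLp 2 fun s => ∑ j, w j * A s j : EuclideanSpace ℝ (Fin T)) t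
        = inner ℝ (WithLp.toLp 2 w : EuclideanSpace ℝ (Fin m)) c := by
    simp only [PiLp.inner_apply, hc, RCLike.inner_apply, conj_trivial, Finset.sum_mul,
      Finset.mul_sum]
    rw [Finset.sum_comm]
    exact Finset.sum_congr rfl fun j _ => Finset.sum_congr rfl fun s _ => by ring
  have h2 := charFun_pi (μ := fun _ : Fin m => gaussianReal 0 v) c
  rw [charFun_apply, integral_map (by fun_prop) (Measurable.aestronglyMeasurable (by fun_prop))]
    at h2
  simp only [h1]
  rw [h2]
  simp only [charFun_gaussianReal, ← Complex.exp_sum]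
  congr 1
  have h3 : t.ofLp ⬝ᵥ ((v : ℝ) • Matrix.of fun s t => ∑ j, A s j * A t j).mulVec t.ofLp
      = v * ∑ j, c j ^ 2 := by
    have h4 (j : Fin m) : c j ^ 2 = ∑ s, ∑ r, A s j * t s * (A r j * t r) := by
      rw [sq, hc, Finset.sum_mul_sum]
    simp only [h4, dotProduct, Matrix.mulVec, Matrix.smul_apply, Matrix.of_apply, smul_eq_mul]
    rw [Finset.sum_comm, Finset.mul_sum]
    refine Finset.sum_congr rfl fun s _ => ?_
    rw [Finset.sum_comm, Finset.mul_sum, Finset.mul_sum]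
    refine Finset.sum_congr rfl fun r _ => ?_
    rw [Finset.mul_sum, Finset.sum_mul, Finset.mul_sum, Finset.mul_sum]
    exact Finset.sum_congr rfl fun j _ => by ring
  rw [h3]
  push_cast
  simp only [inner_zero_right, Complex.ofReal_zero, zero_mul, mul_zero, zero_sub,
    Finset.mul_sum, Finset.sum_div, Finset.sum_neg_distrib]

/-- The bias is the same on all samples, so normalization removes it; this is why `σ_b` never enters
the order parameters. -/
lemma pairAct_preAct (hT : 0 < T) (θ : ParamIdx n H → ℝ) (l : ℕ) (hl : l < H + 1)
    (A : Fin T → Fin (n l) → ℝ) (i : Fin (n (l + 1))) (s t : Fin T) :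
    pairAct f s t (fun r => preAct θ l hl (A r) i)
      = pairAct f s t (fun r => ∑ j, θ (Sum.inl ⟨⟨l, hl⟩, (i, j)⟩) * A r j) := by
  simp only [pairAct, preAct]
  rw [batchNorm_add_const hT]

lemma measurable_pairAct_preAct (hf : Continuous f) (l : ℕ) (hl : l < H + 1)
    (A : Fin T → Fin (n l) → ℝ) (i : Fin (n (l + 1))) (s t : Fin T) :
    Measurable fun θ : ParamIdx n H → ℝ => pairAct f s t (fun r => preAct θ l hl (A r) i) := by
  refine (measurable_pairAct hf s t).comp ?_
  unfold preAct
  fun_prop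

lemma weight_injective (l : ℕ) (hl : l < H + 1) (i : Fin (n (l + 1))) :
    Function.Injective fun j : Fin (n l) => (Sum.inl ⟨⟨l, hl⟩, (i, j)⟩ : ParamIdx n H) := by
  intro j j' h
  simpa using h

/-- Mean of a pair of activations in a random layer acting on a fixed batch. -/
lemma integral_pairAct_preAct (hT : 0 < T) (hf : Continuous f) (l : ℕ) (hl : l < H + 1)
    (A : Fin T → Fin (n l) → ℝ) (i : Fin (n (l + 1))) (s t : Fin T) :
    ∫ θ, pairAct f s t (fun r => preAct θ l hl (A r) i)
        ∂(Measure.pi fun p => gaussianReal 0 (paramVar n H σw σb p))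
      = ∫ u : EuclideanSpace ℝ (Fin T), pairAct f s t (fun r => u r)
          ∂(multivariateGaussian 0 (((σw : ℝ) ^ 2) • overlapMatrix A)) := by
  have hcov : ((σw : ℝ) ^ 2) • overlapMatrix A
      = ((σw ^ 2 / (n l : ℝ≥0) : ℝ≥0) : ℝ) • Matrix.of fun s t => ∑ j, A s j * A t j := by
    ext s t
    simp only [overlapMatrix, Matrix.smul_apply, Matrix.of_apply, smul_eq_mul]
    push_cast
    ring
  have hm : Measurable fun u : EuclideanSpace ℝ (Fin T) => pairAct f s t (fun r => u r) :=
    (measurable_pairAct hf s t).comp (by fun_prop)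
  have hlin : Measurable fun w : Fin (n l) → ℝ =>
      (WithLp.toLp 2 fun s => ∑ j, w j * A s j : EuclideanSpace ℝ (Fin T)) := by fun_prop
  have hg : Measurable fun w : Fin (n l) → ℝ => pairAct f s t fun r =>
      (WithLp.toLp 2 fun s => ∑ j, w j * A s j : EuclideanSpace ℝ (Fin T)) r := hm.comp hlin
  have hmap : (Measure.pi fun p => gaussianReal 0 (paramVar n H σw σb p)).map
      (fun θ j => θ (Sum.inl ⟨⟨l, hl⟩, (i, j)⟩))
      = Measure.pi fun _ : Fin (n l) => gaussianReal 0 (σw ^ 2 / (n l : ℝ≥0)) :=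
    map_pi_comp_injective _ (weight_injective l hl i)
  rw [hcov, ← map_pi_gaussianReal_linear, integral_map hlin.aemeasurable hm.aestronglyMeasurable,
    ← hmap, integral_map (measurable_pi_lambda _ fun j => measurable_pi_apply _).aemeasurable
      hg.aestronglyMeasurable]
  exact integral_congr_ae (ae_of_all _ fun θ => pairAct_preAct hT θ l hl A i s t)

/-- Distinct units of a random layer acting on a fixed batch are independent. -/
lemma indepFun_pairAct_preAct (hT : 0 < T) (hf : Continuous f) (l : ℕ) (hl : l < H + 1)
    (A : Fin T → Fin (n l) → ℝ) {i i' : Fin (n (l + 1))} (hi : i ≠ i') (s t : Fin T) :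
    IndepFun (fun θ => pairAct f s t (fun r => preAct θ l hl (A r) i))
      (fun θ => pairAct f s t (fun r => preAct θ l hl (A r) i'))
      (Measure.pi fun p => gaussianReal 0 (paramVar n H σw σb p)) := by
  have hg : Measurable fun w : Fin (n l) → ℝ => pairAct f s t (fun r => ∑ j, w j * A r j) :=
    (measurable_pairAct hf s t).comp (by fun_prop)
  simp only [pairAct_preAct hT]
  exact indepFun_pi_of_disjoint _
    (e := fun j => (Sum.inl ⟨⟨l, hl⟩, (i, j)⟩ : ParamIdx n H))
    (e' := fun j => (Sum.inl ⟨⟨l, hl⟩, (i', j)⟩ : ParamIdx n H))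
    -- Reading the unit index off as a natural number avoids a dependent equality of layer indices.
    (fun j j' h => hi (by simpa using congrArg (fun p => Sum.elim
      (fun q => (q.2.1 : ℕ)) (fun _ => 0) p) h |> Fin.ext)) hg hg

/-- Concentration of the empirical overlap of a random layer acting on a fixed batch. -/
lemma measure_layer_average_le (hT : 0 < T) (hf : Continuous f) {B : ℝ}
    (hB : ∀ (s t : Fin T) (u : Fin T → ℝ), |pairAct f s t u| ≤ B) (l : ℕ) (hl : l < H + 1)
    (hn : 0 < n (l + 1)) (A : Fin T → Fin (n l) → ℝ) (s t : Fin T) {ε : ℝ} (hε : 0 < ε) :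
    (Measure.pi fun p => gaussianReal 0 (paramVar n H σw σb p))
        {θ | ε ≤ |(∑ i, pairAct f s t (fun r => preAct θ l hl (A r) i)) / (n (l + 1) : ℝ)
          - ∫ u : EuclideanSpace ℝ (Fin T), pairAct f s t (fun r => u r)
              ∂(multivariateGaussian 0 (((σw : ℝ) ^ 2) • overlapMatrix A))|}
      ≤ ENNReal.ofReal (B ^ 2 / (n (l + 1) * ε ^ 2)) := by
  have hb (i : Fin (n (l + 1))) : MemLp
      (fun θ : ParamIdx n H → ℝ => pairAct f s t (fun r => preAct θ l hl (A r) i)) 2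
      (Measure.pi fun p => gaussianReal 0 (paramVar n H σw σb p)) :=
    .of_bound (measurable_pairAct_preAct hf l hl A i s t).aestronglyMeasurable B
      (ae_of_all _ fun θ => hB s t _)
  refine measure_average_le hn hb (fun i j h => indepFun_pairAct_preAct hT hf l hl A h s t)
    (fun i => integral_pairAct_preAct hT hf l hl A i s t) (fun i => ?_) hε
  calc ∫ θ, pairAct f s t (fun r => preAct θ l hl (A r) i) ^ 2
        ∂(Measure.pi fun p => gaussianReal 0 (paramVar n H σw σb p))
      ≤ ∫ _, B ^ 2 ∂(Measure.pi fun p => gaussianReal 0 (paramVar n H σw σb p)) := by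
        refine integral_mono (hb i).integrable_sq (integrable_const _) fun θ => ?_
        exact sq_le_sq' (neg_le_of_abs_le (hB s t _)) (le_of_abs_le (hB s t _))
    _ = B ^ 2 := by simp

end Layer

/-! ### The input layer -/

section Input

variable {T m : ℕ}

/-- Flattening the inputs to one product over pairs makes independence of disjoint coordinate sets
available. -/
lemma measurePreserving_uncurry_pi {ι κ X : Type*} [Fintype ι] [Fintype κ] [MeasurableSpace X]
    (μ : Measure X) [IsProbabilityMeasure μ] :
    MeasurePreserving (fun (x : ι → κ → X) (p : ι × κ) => x p.1 p.2)
      (Measure.pi fun _ => Measure.pi fun _ => μ) (Measure.pi fun _ => μ) := by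
  refine ⟨by fun_prop, ?_⟩
  have h := iIndepFun_uncurry_infinitePi' (X := fun (_ : ι) (_ : κ) (x : X) => x)
    (fun _ _ => μ) (fun _ _ => measurable_id)
  simp only [Measure.infinitePi_eq_pi] at h
  rw [iIndepFun_iff_map_fun_eq_pi_map fun p =>
    ((measurable_pi_apply p.2).comp (measurable_pi_apply p.1)).aemeasurable] at h
  rw [h]
  congr 1
  funext p
  have h1 := measurePreserving_eval (fun _ : ι => Measure.pi fun _ : κ => μ) p.1
  have h2 := measurePreserving_eval (fun _ : κ => μ) p.2
  exact (h2.comp h1).map_eq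

/-- The empirical overlaps of independent standard Gaussian inputs concentrate. -/
lemma measure_input_overlap_le (hm : 0 < m) (s t : Fin T) {ε : ℝ} (hε : 0 < ε) :
    (Measure.pi fun _ : Fin T => Measure.pi fun _ : Fin m => gaussianReal 0 1)
        {x | ε ≤ |(∑ i, x s i * x t i) / (m : ℝ) - (1 : Matrix (Fin T) (Fin T) ℝ) s t|}
      ≤ ENNReal.ofReal ((2 * ∫ y, y ^ 4 ∂(gaussianReal 0 1)) / (m * ε ^ 2)) := by
  set ρ : Measure (Fin T × Fin m → ℝ) := Measure.pi fun _ => gaussianReal 0 1 with hρ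
  have hmp := measurePreserving_uncurry_pi (ι := Fin T) (κ := Fin m) (gaussianReal 0 1)
  have hmeas : MeasurableSet {w : Fin T × Fin m → ℝ |
      ε ≤ |(∑ i, w (s, i) * w (t, i)) / (m : ℝ) - (1 : Matrix (Fin T) (Fin T) ℝ) s t|} :=
    measurableSet_le measurable_const (by fun_prop)
  have hpre := hmp.measure_preimage hmeas.nullMeasurableSet
  refine (le_of_eq hpre).trans ?_
  have hev (p : Fin T × Fin m) : MeasurePreserving (fun w : Fin T × Fin m → ℝ => w p) ρ
      (gaussianReal 0 1) := measurePreserving_eval _ p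
  have h4 : Integrable (fun y : ℝ => y ^ 4) (gaussianReal 0 1) := by
    have := (memLp_id_gaussianReal' (μ := 0) (v := 1) ((4 : ℕ) : ℝ≥0∞)
      (ENNReal.natCast_ne_top 4)).integrable_norm_pow (by norm_num)
    refine this.congr (ae_of_all _ fun y => ?_)
    simp [Even.pow_abs (by decide : Even 4)]
  have h4' (p : Fin T × Fin m) : Integrable (fun w : Fin T × Fin m → ℝ => w p ^ 4) ρ :=
    (hev p).integrable_comp_of_integrable h4
  have h4i (p : Fin T × Fin m) : ∫ w, w p ^ 4 ∂ρ = ∫ y, y ^ 4 ∂(gaussianReal 0 1) := by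
    rw [← (hev p).map_eq, integral_map (hev p).measurable.aemeasurable (by fun_prop)]
  -- Source of the constant `2 E[y⁴]`; it treats `s = t` and `s ≠ t` at once.
  have hle (w : Fin T × Fin m → ℝ) (i : Fin m) :
      (w (s, i) * w (t, i)) ^ 2 ≤ w (s, i) ^ 4 + w (t, i) ^ 4 := by
    nlinarith [sq_nonneg (w (s, i) ^ 2 - w (t, i) ^ 2), sq_nonneg (w (s, i) ^ 2),
      sq_nonneg (w (t, i) ^ 2)]
  have hsq (i : Fin m) : Integrable (fun w : Fin T × Fin m → ℝ => (w (s, i) * w (t, i)) ^ 2) ρ :=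
    ((h4' (s, i)).add (h4' (t, i))).mono' (by fun_prop) (ae_of_all _ fun w => by
      rw [Real.norm_of_nonneg (sq_nonneg _)]; exact hle w i)
  refine measure_average_le (μ := ρ) hm (Z := fun i w => w (s, i) * w (t, i))
    (m := (1 : Matrix (Fin T) (Fin T) ℝ) s t) (V := 2 * ∫ y, y ^ 4 ∂(gaussianReal 0 1))
    (fun i => (memLp_two_iff_integrable_sq (by fun_prop)).2 (hsq i)) (fun i j hij => ?_)
    (fun i => ?_) (fun i => ?_) hε
  -- `Bool` indexes the two samples. The map is not injective when `s = t`, but only disjointness of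
  -- the ranges for `i ≠ j` is required.
  · refine indepFun_pi_of_disjoint _ (e := fun b : Bool => (cond b s t, i))
      (e' := fun b : Bool => (cond b s t, j)) (fun b b' h => hij (congrArg Prod.snd h))
      (g := fun w : Bool → ℝ => w true * w false) (g' := fun w : Bool → ℝ => w true * w false)
      (by fun_prop) (by fun_prop)
  · by_cases hst : s = t
    · subst hst
      have hv := variance_id_gaussianReal (μ := 0) (v := 1)
      rw [variance_eq_integral (by fun_prop)] at hv
      simp only [id, integral_id_gaussianReal, sub_zero] at hv
      have : ∫ w, w (s, i) ^ 2 ∂ρ = ∫ y, y ^ 2 ∂(gaussianReal 0 1) := by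
        rw [← (hev (s, i)).map_eq,
          integral_map (hev (s, i)).measurable.aemeasurable (by fun_prop)]
      simp only [← sq, this, hv]
      simp
    · have hind : IndepFun (fun w : Fin T × Fin m → ℝ => w (s, i)) (fun w => w (t, i)) ρ :=
        indepFun_pi_of_disjoint _ (e := fun _ : Unit => (s, i)) (e' := fun _ : Unit => (t, i))
          (fun _ _ h => hst (congrArg Prod.fst h)) (g := fun w => w ()) (g' := fun w => w ())
          (by fun_prop) (by fun_prop)
      have hmean : ∫ w, w (s, i) ∂ρ = 0 := by
        have := integral_map (hev (s, i)).measurable.aemeasurable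
          (aestronglyMeasurable_id (μ := ρ.map fun w => w (s, i)) (α := ℝ))
        rw [(hev (s, i)).map_eq] at this
        simpa using this.symm
      rw [hind.integral_fun_mul_eq_mul_integral
        (hev (s, i)).measurable.aestronglyMeasurable (hev (t, i)).measurable.aestronglyMeasurable,
        hmean]
      simp [hst]
  · calc ∫ w, (w (s, i) * w (t, i)) ^ 2 ∂ρ
        ≤ ∫ w, (w (s, i) ^ 4 + w (t, i) ^ 4) ∂ρ :=
          integral_mono (hsq i) ((h4' _).add (h4' _)) fun w => hle w i
      _ = 2 * ∫ y, y ^ 4 ∂(gaussianReal 0 1) := by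
          rw [integral_add (h4' _) (h4' _), h4i, h4i, two_mul]

end Input

/-! ### Hidden layers -/

section Hidden

variable {n : ℕ → ℕ} {H T : ℕ} {φ : ℕ → ℝ → ℝ}

/-- The layer whose outputs are combined by the parameter `p`. -/
def paramLayer (p : ParamIdx n H) : ℕ := Sum.elim (fun q => q.1.val) (fun q => q.1.val) p

lemma preAct_congr {θ θ' : ParamIdx n H → ℝ} (l : ℕ) (hl : l < H + 1)
    (h : ∀ p, paramLayer p = l → θ p = θ' p) (a : Fin (n l) → ℝ) (i : Fin (n (l + 1))) :
    preAct θ l hl a i = preAct θ' l hl a i := by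
  unfold preAct
  rw [h _ rfl]
  congr 1
  exact Finset.sum_congr rfl fun j _ => by rw [h _ rfl]

/-- This plays the role of adaptedness: redrawing the parameters of layer index `l` leaves the
layer-`l` outputs fixed. -/
lemma hiddenOut_congr {θ θ' : ParamIdx n H → ℝ} (x : Fin T → Fin (n 0) → ℝ) (l : ℕ)
    (hl : l < H + 1) (h : ∀ p, paramLayer p < l → θ p = θ' p) :
    hiddenOut φ θ x l hl = hiddenOut φ θ' x l hl := by
  induction l with
  | zero => rfl
  | succ l ih =>
    funext t i
    simp only [hiddenOut]
    rw [ih (by omega) fun p hp => h p (by omega)]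
    congr 2
    funext s
    exact preAct_congr l _ (fun p hp => h p (by omega)) _ i

lemma measurable_hiddenOut (l : ℕ) (hl : l < H + 1) (hφ : ∀ k, 1 ≤ k → k ≤ l → Continuous (φ k))
    (t : Fin T) (i : Fin (n l)) :
    Measurable fun ω : (ParamIdx n H → ℝ) × (Fin T → Fin (n 0) → ℝ) =>
      hiddenOut φ ω.1 ω.2 l hl t i := by
  induction l generalizing t with
  | zero => simp only [hiddenOut]; fun_prop
  | succ l ih =>
    simp only [hiddenOut]
    have hm := fun s j => ih (by omega) (fun k h1 h2 => hφ k h1 (by omega)) s j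
    have hpre : Measurable fun (ω : (ParamIdx n H → ℝ) × (Fin T → Fin (n 0) → ℝ)) (s : Fin T) =>
        preAct ω.1 l (Nat.lt_of_succ_lt hl)
          (hiddenOut φ ω.1 ω.2 l (Nat.lt_of_succ_lt hl) s) i := by
      unfold preAct
      fun_prop
    exact (hφ (l + 1) (by omega) le_rfl).measurable.comp ((measurable_batchNorm t).comp hpre)

lemma measurable_overlap (l : ℕ) (hl : l < H + 1) (hφ : ∀ k, 1 ≤ k → k ≤ l → Continuous (φ k))
    (s t : Fin T) :
    Measurable fun ω : (ParamIdx n H → ℝ) × (Fin T → Fin (n 0) → ℝ) =>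
      overlap φ ω.1 ω.2 l hl s t := by
  have := fun s i => measurable_hiddenOut (n := n) (T := T) l hl hφ s i
  unfold overlap
  fun_prop

lemma overlap_succ (θ : ParamIdx n H → ℝ) (x : Fin T → Fin (n 0) → ℝ) (l : ℕ)
    (hl : l + 1 < H + 1) (s t : Fin T) :
    overlap φ θ x (l + 1) hl s t
      = (∑ i, pairAct (φ (l + 1)) s t (fun r => preAct θ l (Nat.lt_of_succ_lt hl)
          (hiddenOut φ θ x l (Nat.lt_of_succ_lt hl) r) i)) / (n (l + 1) : ℝ) := rfl

/-- Replaces conditioning on earlier layers: the coordinates in `S` are redrawn with the others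
frozen, so a bound for each frozen point can be integrated. -/
lemma prod_apply_resample {ι X Y : Type*} [Fintype ι] [MeasurableSpace X] [MeasurableSpace Y]
    (μ : ι → Measure X) [∀ i, IsProbabilityMeasure (μ i)] (ν : Measure Y) [SFinite ν] (S : Set ι)
    [∀ i, Decidable (i ∈ S)] {A : Set ((ι → X) × Y)} (hA : MeasurableSet A) :
    (Measure.pi μ).prod ν A
      = ∫⁻ ω, Measure.pi μ {θ' | (S.piecewise θ' ω.1, ω.2) ∈ A} ∂((Measure.pi μ).prod ν) := by
  have hm : Measurable fun p : (ι → X) × (ι → X) => S.piecewise p.2 p.1 := by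
    refine measurable_pi_iff.2 fun i => ?_
    by_cases hi : i ∈ S
    · simp only [Set.piecewise, hi, if_true]; fun_prop
    · simp only [Set.piecewise, hi, if_false]; fun_prop
  have hbig : MeasurableSet {q : ((ι → X) × Y) × (ι → X) | (S.piecewise q.2 q.1.1, q.1.2) ∈ A} := by
    refine measurableSet_preimage ?_ hA
    exact (hm.comp (by fun_prop : Measurable fun q : ((ι → X) × Y) × (ι → X) =>
      (q.1.1, q.2))).prodMk (by fun_prop)
  rw [lintegral_prod_symm' (fun ω : (ι → X) × Y =>
    Measure.pi μ {θ' | (S.piecewise θ' ω.1, ω.2) ∈ A}) (measurable_measure_prodMk_left hbig),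
    Measure.prod_apply_symm hA]
  refine lintegral_congr fun y => ?_
  have hAy : MeasurableSet ((fun θ => (θ, y)) ⁻¹' A) := measurable_prodMk_right hA
  conv_lhs => rw [← map_piecewise_pi μ S, Measure.map_apply hm hAy,
    Measure.prod_apply (hm hAy)]
  rfl

variable {σw σb : ℝ≥0}

instance isProbabilityMeasure_ensemble : IsProbabilityMeasure (ensemble n H T σw σb) := by
  unfold ensemble; infer_instance

/-- Propagation of the concentration of the overlaps through one layer. -/
lemma ensemble_overlap_succ_le (hT : 0 < T) (l : ℕ) (hl : l + 1 < H + 1)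
    (hφ : ∀ k, 1 ≤ k → k ≤ l + 1 → Continuous (φ k)) {B : ℝ}
    (hB : ∀ (s t : Fin T) (u : Fin T → ℝ), |pairAct (φ (l + 1)) s t u| ≤ B)
    (hn : 0 < n (l + 1)) {ε δ : ℝ} (hε : 0 < ε) (s t : Fin T) {Q : Matrix (Fin T) (Fin T) ℝ} {q : ℝ}
    (hδ : ∀ {m : ℕ} (A : Fin T → Fin m → ℝ), (∀ s t, |overlapMatrix A s t - Q s t| < δ) →
      |∫ u : EuclideanSpace ℝ (Fin T), pairAct (φ (l + 1)) s t (fun r => u r)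
          ∂(multivariateGaussian 0 (((σw : ℝ) ^ 2) • overlapMatrix A)) - q| < ε / 2) :
    ensemble n H T σw σb {ω | ε ≤ |overlap φ ω.1 ω.2 (l + 1) hl s t - q|}
      ≤ ∑ s', ∑ t', ensemble n H T σw σb
          {ω | δ ≤ |overlap φ ω.1 ω.2 l (Nat.lt_of_succ_lt hl) s' t' - Q s' t'|}
        + ENNReal.ofReal (B ^ 2 / (n (l + 1) * (ε / 2) ^ 2)) := by
  classical
  set hl' : l < H + 1 := Nat.lt_of_succ_lt hl
  have hmeas : MeasurableSet {ω : (ParamIdx n H → ℝ) × (Fin T → Fin (n 0) → ℝ) |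
      ε ≤ |overlap φ ω.1 ω.2 (l + 1) hl s t - q|} := by
    have := measurable_overlap (n := n) (T := T) (l + 1) hl hφ s t
    exact measurableSet_le measurable_const (by fun_prop)
  set Bad : Set ((ParamIdx n H → ℝ) × (Fin T → Fin (n 0) → ℝ)) :=
    ⋃ s', ⋃ t', {ω | δ ≤ |overlap φ ω.1 ω.2 l hl' s' t' - Q s' t'|} with hBad
  have hBadm : MeasurableSet Bad := by
    refine MeasurableSet.iUnion fun s' => MeasurableSet.iUnion fun t' => ?_
    have := measurable_overlap (n := n) (T := T) l hl' (fun k h1 h2 => hφ k h1 (by omega)) s' t'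
    exact measurableSet_le measurable_const (by fun_prop)
  set c := ENNReal.ofReal (B ^ 2 / (n (l + 1) * (ε / 2) ^ 2)) with hc
  set π := Measure.pi fun p => gaussianReal 0 (paramVar n H σw σb p) with hπ
  set S : Set (ParamIdx n H) := {p | paramLayer p = l} with hS
  have hpt (ω : (ParamIdx n H → ℝ) × (Fin T → Fin (n 0) → ℝ)) :
      π {θ' | (S.piecewise θ' ω.1, ω.2) ∈
          {ω | ε ≤ |overlap φ ω.1 ω.2 (l + 1) hl s t - q|}}
        ≤ Bad.indicator 1 ω + c := by
    -- On `Bad` the trivial bound `1` suffices. Off it, the conditional mean is within `ε / 2` of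
    -- `q`, and Chebyshev controls the remaining fluctuation of size `ε / 2`.
    by_cases hω : ω ∈ Bad
    · rw [Set.indicator_of_mem hω]
      exact prob_le_one.trans le_self_add
    · rw [Set.indicator_of_notMem hω, zero_add]
      have hclose : ∀ s t, |overlapMatrix (hiddenOut φ ω.1 ω.2 l hl') s t - Q s t| < δ := by
        intro s' t'
        by_contra h
        exact hω (Set.mem_iUnion₂.2 ⟨s', t', not_lt.1 h⟩)
      have hmean := hδ _ hclose
      refine le_trans (measure_mono fun θ' hθ' => ?_)
        (measure_layer_average_le (σw := σw) (σb := σb) hT (hφ (l + 1) (by omega) le_rfl) hB l hl'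
          hn (hiddenOut φ ω.1 ω.2 l hl') s t (half_pos hε))
      have hout : hiddenOut φ (S.piecewise θ' ω.1) ω.2 l hl' = hiddenOut φ ω.1 ω.2 l hl' :=
        hiddenOut_congr _ l hl' fun p hp => Set.piecewise_eq_of_notMem S _ _ (by
          simp only [hS, Set.mem_ofPred_eq]; omega)
      have hpre (a : Fin (n l) → ℝ) (i : Fin (n (l + 1))) :
          preAct (S.piecewise θ' ω.1) l hl' a i = preAct θ' l hl' a i :=
        preAct_congr l hl' (fun p hp => Set.piecewise_eq_of_mem S _ _ hp) a i
      have hθ'' : ε ≤ |overlap φ (S.piecewise θ' ω.1) ω.2 (l + 1) hl s t - q| := hθ'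
      rw [overlap_succ, hout] at hθ''
      simp only [hpre] at hθ''
      simp only [Set.mem_ofPred_eq]
      have htri := abs_sub_le ((∑ i, pairAct (φ (l + 1)) s t (fun r => preAct θ' l hl'
        (hiddenOut φ ω.1 ω.2 l hl' r) i)) / (n (l + 1) : ℝ))
        (∫ u : EuclideanSpace ℝ (Fin T), pairAct (φ (l + 1)) s t (fun r => u r)
          ∂(multivariateGaussian 0 (((σw : ℝ) ^ 2) • overlapMatrix
            (hiddenOut φ ω.1 ω.2 l hl')))) q
      linarith
  calc ensemble n H T σw σb {ω | ε ≤ |overlap φ ω.1 ω.2 (l + 1) hl s t - q|}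
      = ∫⁻ ω, π {θ' | (S.piecewise θ' ω.1, ω.2) ∈
          {ω | ε ≤ |overlap φ ω.1 ω.2 (l + 1) hl s t - q|}} ∂(ensemble n H T σw σb) := by
        rw [ensemble, prod_apply_resample _ _ S hmeas]
    _ ≤ ∫⁻ ω, (Bad.indicator 1 ω + c) ∂(ensemble n H T σw σb) := lintegral_mono hpt
    _ = ensemble n H T σw σb Bad + c := by
        rw [lintegral_add_right _ measurable_const, lintegral_indicator_one hBadm]
        simp
    _ ≤ _ := by
        gcongr
        refine (measure_iUnion_fintype_le _ _).trans (Finset.sum_le_sum fun s' _ => ?_)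
        exact measure_iUnion_fintype_le _ _

/-- Gaussian means of pairs of activations are continuous in the covariance at an exchangeable
nondegenerate covariance. -/
lemma exists_delta_integral_pairAct (hT : 2 ≤ T) {f : ℝ → ℝ} (hf : Continuous f) (hσw : 0 < σw)
    {a b : ℝ} (ha : 0 < a) (hb : 0 ≤ b) {Q : Matrix (Fin T) (Fin T) ℝ}
    (hQ : ∀ s t, Q s t = (if s = t then a else 0) + b) (s t : Fin T) {ε : ℝ} (hε : 0 < ε) :
    ∃ δ > 0, ∀ {m : ℕ} (A : Fin T → Fin m → ℝ), (∀ s t, |overlapMatrix A s t - Q s t| < δ) →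
      |∫ u : EuclideanSpace ℝ (Fin T), pairAct f s t (fun r => u r)
          ∂(multivariateGaussian 0 (((σw : ℝ) ^ 2) • overlapMatrix A))
        - ∫ u : EuclideanSpace ℝ (Fin T), pairAct f s t (fun r => u r)
          ∂(multivariateGaussian 0 (((σw : ℝ) ^ 2) • Q))| < ε := by
  have hσ : (0 : ℝ) < (σw : ℝ) ^ 2 := by positivity
  have hS : ∀ s t, (((σw : ℝ) ^ 2) • Q) s t
      = (if s = t then (σw : ℝ) ^ 2 * a else 0) + (σw : ℝ) ^ 2 * b := fun s t => by
    simp [hQ, mul_add]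
  have hlim := tendsto_integral_pairAct hT hf (a := (σw : ℝ) ^ 2 * a) (b := (σw : ℝ) ^ 2 * b)
    (by positivity) (by positivity) hS
    (posSemidef_of_exchangeable (by positivity) (by positivity) hS) s t
  have hev := hlim.eventually (Metric.ball_mem_nhds _ hε)
  rw [eventually_nhdsWithin_iff] at hev
  -- Passing to plain functions makes `δ` an entrywise tolerance. It is chosen before the width `m`,
  -- hence is uniform in it.
  have hcont : Continuous fun K : Fin T → Fin T → ℝ =>
      ((σw : ℝ) ^ 2) • (Matrix.of K : Matrix (Fin T) (Fin T) ℝ) :=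
    (continuous_id (X := Fin T → Fin T → ℝ)).const_smul ((σw : ℝ) ^ 2)
  have hev' := (hcont.tendsto fun s t => Q s t).eventually hev
  obtain ⟨δ, hδ, h⟩ := Metric.eventually_nhds_iff.1 hev'
  refine ⟨δ, hδ, fun A hA => ?_⟩
  refine h (y := fun s t => overlapMatrix A s t) ?_ (posSemidef_overlapMatrix A hσ.le)
  rw [dist_pi_lt_iff hδ]
  intro s
  rw [dist_pi_lt_iff hδ]
  exact fun t => hA s t

lemma tendsto_width {w : ℕ → ℕ} {α : ℝ} (hα : 0 < α)
    (hw : Tendsto (fun M : ℕ => (w M : ℝ) / (M : ℝ)) atTop (𝓝 α)) :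
    Tendsto (fun M => (w M : ℝ)) atTop atTop := by
  have h := hw.pos_mul_atTop hα (tendsto_natCast_atTop_atTop (R := ℝ))
  refine h.congr' ?_
  filter_upwards [eventually_gt_atTop 0] with M hM
  have : (M : ℝ) ≠ 0 := by positivity
  field_simp

lemma tendsto_chebyshev {w : ℕ → ℕ} (hw : Tendsto (fun M => (w M : ℝ)) atTop atTop) (V : ℝ) {ε : ℝ}
    (hε : 0 < ε) :
    Tendsto (fun M => ENNReal.ofReal (V / (w M * ε ^ 2))) atTop (𝓝 0) := by
  rw [← ENNReal.ofReal_zero]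
  exact ENNReal.tendsto_ofReal ((hw.atTop_mul_const (by positivity)).const_div_atTop V)

end Hidden

/-- In every hidden layer the overlaps converge in probability to the order parameters. -/
lemma tendsto_overlap {H T : ℕ} (hT : 2 ≤ T) {σw : ℝ≥0} (hσw : 0 < σw) {φ : ℕ → ℝ → ℝ}
    (hφ : ∀ l, 1 ≤ l → l ≤ H → Continuous (φ l))
    (hφ_nonneg : ∀ l, 1 ≤ l → l ≤ H → ∀ x, 0 ≤ φ l x)
    (hφ_nonconst : ∀ l, 1 ≤ l → l < H →
      ∃ z : Fin T → ℝ, IsNormalizedBatch z ∧ ∃ s t, φ l (z s) ≠ φ l (z t))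
    (σb : ℝ≥0) {n : ℕ → ℕ → ℕ} (hn : ∀ l, l ≤ H → Tendsto (fun M => (n M l : ℝ)) atTop atTop)
    (l : ℕ) (hl : l < H + 1) (s t : Fin T) {ε : ℝ} (hε : 0 < ε) :
    Tendsto (fun M => ensemble (n M) H T σw σb
      {ω | ε ≤ |overlap φ ω.1 ω.2 l hl s t - orderParam φ σw T l s t|}) atTop (𝓝 0) := by
  induction l generalizing s t ε with
  | zero =>
    refine tendsto_of_tendsto_of_tendsto_of_le_of_le' tendsto_const_nhds
      (tendsto_chebyshev (hn 0 (by omega)) (2 * ∫ y, y ^ 4 ∂(gaussianReal 0 1)) hε)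
      (.of_forall fun _ => zero_le) ?_
    filter_upwards [(hn 0 (by omega)).eventually_gt_atTop 0] with M hM
    refine le_trans (le_of_eq ?_) (measure_input_overlap_le (T := T) (by exact_mod_cast hM) s t hε)
    have h : {ω : (ParamIdx (n M) H → ℝ) × (Fin T → Fin (n M 0) → ℝ) |
        ε ≤ |overlap φ ω.1 ω.2 0 hl s t - orderParam φ σw T 0 s t|}
        = Set.univ ×ˢ {x : Fin T → Fin (n M 0) → ℝ | ε ≤ |(∑ i, x s i * x t i) / (n M 0 : ℝ)
            - (1 : Matrix (Fin T) (Fin T) ℝ) s t|} := by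
      ext ω
      simp [overlap, hiddenOut, orderParam]
    rw [h, ensemble, Measure.prod_prod, measure_univ, one_mul]
  | succ l ih =>
    obtain ⟨a, b, ha, hb, hQ⟩ := exists_orderParam_eq (σw := σw) hT hσw hφ hφ_nonneg hφ_nonconst l
      (by omega)
    have hc := hφ (l + 1) (by omega) (by omega)
    obtain ⟨B, hB⟩ := exists_abs_pairAct_le (T := T) (by omega) hc
    obtain ⟨δ, hδ, hδ'⟩ := exists_delta_integral_pairAct hT hc hσw ha hb hQ s t (half_pos hε)
    have hlim : Tendsto (fun M => ∑ s', ∑ t', ensemble (n M) H T σw σb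
          {ω | δ ≤ |overlap φ ω.1 ω.2 l (Nat.lt_of_succ_lt hl) s' t'
            - orderParam φ σw T l s' t'|}
        + ENNReal.ofReal (B ^ 2 / (n M (l + 1) * (ε / 2) ^ 2))) atTop (𝓝 0) := by
      have h1 := tendsto_finsetSum (Finset.univ : Finset (Fin T)) fun s' _ =>
        tendsto_finsetSum (Finset.univ : Finset (Fin T)) fun t' _ =>
          ih (Nat.lt_of_succ_lt hl) s' t' hδ
      have h2 := h1.add (tendsto_chebyshev (hn (l + 1) (by omega)) (B ^ 2) (half_pos hε))
      simpa using h2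
    refine tendsto_of_tendsto_of_tendsto_of_le_of_le' tendsto_const_nhds hlim
      (.of_forall fun _ => zero_le) ?_
    filter_upwards [(hn (l + 1) (by omega)).eventually_gt_atTop 0] with M hM
    -- The centre in `hδ'` is by definition the `(s, t)` entry of `orderParam` in layer `l + 1`.
    exact ensemble_overlap_succ_le (by omega) l hl (fun k h1 h2 => hφ k h1 (by omega)) hB
      (by exact_mod_cast hM) hε s t hδ'

/-! ### The largest eigenvalue -/

section Eigenvalue

variable {ι : Type*} [Fintype ι] [DecidableEq ι] {A : Matrix ι ι ℝ}

/-- The Rayleigh bound for the largest eigenvalue of a symmetric matrix. -/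
lemma dotProduct_mulVec_le_maxEigenvalue (hA : A.IsHermitian) (v : ι → ℝ) :
    v ⬝ᵥ A.mulVec v ≤ maxEigenvalue A * (v ⬝ᵥ v) := by
  -- Finiteness of the spectrum makes the `sSup` an upper bound rather than a default value.
  have hbdd : BddAbove {r : ℝ | Module.End.HasEigenvalue (Matrix.toLin' A) r} :=
    (Module.End.finite_hasEigenvalue (Matrix.toLin' A)).bddAbove
  have hle (i : ι) : hA.eigenvalues i ≤ maxEigenvalue A := by
    refine le_csSup hbdd ?_
    refine Module.End.hasEigenvalue_of_hasEigenvector (x := (hA.eigenvectorBasis i).ofLp)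
      (Module.End.hasEigenvector_iff.2 ⟨Module.End.mem_eigenspace_iff.2 ?_, fun h => ?_⟩)
    · simpa using hA.mulVec_eigenvectorBasis i
    · have := hA.eigenvectorBasis.orthonormal.ne_zero i
      exact this (WithLp.ofLp_injective 2 h)
  set x : EuclideanSpace ℝ ι := WithLp.toLp 2 v with hx
  set y : EuclideanSpace ℝ ι := WithLp.toLp 2 (A.mulVec v) with hy
  have hin (a b : ι → ℝ) : a ⬝ᵥ b
      = inner ℝ (WithLp.toLp 2 a : EuclideanSpace ℝ ι) (WithLp.toLp 2 b) := by
    simp [PiLp.inner_apply, dotProduct, mul_comm]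
  have hcoef (i : ι) : inner ℝ (hA.eigenvectorBasis i) y
      = hA.eigenvalues i * inner ℝ (hA.eigenvectorBasis i) x := by
    have h1 : inner ℝ (hA.eigenvectorBasis i) y
        = (hA.eigenvectorBasis i).ofLp ⬝ᵥ A.mulVec v := (hin _ _).symm
    have h2 : inner ℝ (hA.eigenvectorBasis i) x = (hA.eigenvectorBasis i).ofLp ⬝ᵥ v :=
      (hin _ _).symm
    have hsymm : A.transpose = A := by simpa using hA.eq
    rw [h1, h2, Matrix.dotProduct_mulVec, ← Matrix.mulVec_transpose, hsymm,
      hA.mulVec_eigenvectorBasis i, smul_dotProduct, smul_eq_mul]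
  rw [hin v (A.mulVec v), hin v v, ← hA.eigenvectorBasis.sum_inner_mul_inner x y,
    ← hA.eigenvectorBasis.sum_inner_mul_inner x x, Finset.mul_sum]
  refine Finset.sum_le_sum fun i _ => ?_
  rw [hcoef, real_inner_comm x]
  nlinarith [hle i, mul_self_nonneg (inner ℝ (hA.eigenvectorBasis i) x)]

/-- Covers the case of a vanishing test vector, including an empty spectrum, where `sSup ∅ = 0`. -/
lemma maxEigenvalue_nonneg (hA : A.PosSemidef) : 0 ≤ maxEigenvalue A := by
  refine Real.sSup_nonneg fun r hr => ?_
  obtain ⟨v, hv⟩ := Module.End.HasEigenvalue.exists_hasEigenvector hr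
  have hmul : A.mulVec v = r • v := by simpa using hv.apply_eq_smul
  have h := hA.dotProduct_mulVec_nonneg v
  rw [hmul, star_trivial, dotProduct_smul, smul_eq_mul] at h
  have hpos : 0 < v ⬝ᵥ v := by
    have := Matrix.dotProduct_star_self_pos_iff.2 hv.2
    simpa using this
  exact nonneg_of_mul_nonneg_left h hpos

end Eigenvalue

/-! ### The Fisher information matrix -/

section Fisher

variable {n : ℕ → ℕ} {H T : ℕ} {φ : ℕ → ℝ → ℝ}

/-- As a sum of squares, the form can be bounded below by keeping a single output `k`. -/
lemma dotProduct_fim_mulVec (θ : ParamIdx n H → ℝ) (x : Fin T → Fin (n 0) → ℝ)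
    (v : ParamIdx n H → ℝ) :
    v ⬝ᵥ (fim φ θ x).mulVec v
      = ∑ k, (∑ t, (∑ p, outputPartial φ θ x t k p * v p) ^ 2) / (T : ℝ) := by
  have hL : v ⬝ᵥ (fim φ θ x).mulVec v = ∑ p, ∑ p', ∑ k, (∑ t, (outputPartial φ θ x t k p * v p)
      * (outputPartial φ θ x t k p' * v p')) / (T : ℝ) := by
    simp only [dotProduct, Matrix.mulVec, fim, Matrix.of_apply, Finset.mul_sum, Finset.sum_mul,
      Finset.sum_div]
    refine Finset.sum_congr rfl fun p _ => Finset.sum_congr rfl fun p' _ =>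
      Finset.sum_congr rfl fun k _ => Finset.sum_congr rfl fun t _ => by ring
  have hR (k : Fin (n (H + 1))) : (∑ t, (∑ p, outputPartial φ θ x t k p * v p) ^ 2) / (T : ℝ)
      = ∑ p, ∑ p', (∑ t, (outputPartial φ θ x t k p * v p)
        * (outputPartial φ θ x t k p' * v p')) / (T : ℝ) := by
    simp only [sq, Finset.sum_mul_sum, Finset.sum_div]
    rw [Finset.sum_comm]
    exact Finset.sum_congr rfl fun p _ => Finset.sum_comm
  simp only [hR]
  symm
  rw [hL, Finset.sum_comm]
  exact Finset.sum_congr rfl fun p _ => Finset.sum_comm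

lemma posSemidef_fim (θ : ParamIdx n H → ℝ) (x : Fin T → Fin (n 0) → ℝ) :
    (fim φ θ x).PosSemidef := by
  refine Matrix.PosSemidef.of_dotProduct_mulVec_nonneg ?_ fun v => ?_
  · ext p p'
    simp [fim, mul_comm]
  · rw [star_trivial, dotProduct_fim_mulVec]
    positivity

/-- The derivative of an output with respect to a weight of the output layer. -/
lemma outputPartial_last (θ : ParamIdx n H → ℝ) (x : Fin T → Fin (n 0) → ℝ) (t : Fin T)
    (k : Fin (n (H + 1))) (j : Fin (n H)) :
    outputPartial φ θ x t k (Sum.inl ⟨⟨H, Nat.lt_succ_self H⟩, (k, j)⟩)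
      = hiddenOut φ θ x H (Nat.lt_succ_self H) t j := by
  set p : ParamIdx n H := Sum.inl ⟨⟨H, Nat.lt_succ_self H⟩, (k, j)⟩ with hp
  set h := hiddenOut φ θ x H (Nat.lt_succ_self H) t with hh
  -- The output is affine in this weight because the hidden layers do not see it; the partial
  -- derivative therefore exists at every parameter.
  have key (y : ℝ) : netOutput φ (Function.update θ p y) x t k
      = y * h j + (netOutput φ θ x t k - θ p * h j) := by
    have hout : hiddenOut φ (Function.update θ p y) x H (Nat.lt_succ_self H)
        = hiddenOut φ θ x H (Nat.lt_succ_self H) := by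
      refine hiddenOut_congr x H _ fun q hq => Function.update_of_ne ?_ _ _
      rintro rfl
      simp [paramLayer, hp] at hq
    have hsum : ∑ i, Function.update θ p y (Sum.inl ⟨⟨H, Nat.lt_succ_self H⟩, (k, i)⟩) * h i
        = y * h j + (∑ i, θ (Sum.inl ⟨⟨H, Nat.lt_succ_self H⟩, (k, i)⟩) * h i - θ p * h j) := by
      rw [← Finset.add_sum_erase _ _ (Finset.mem_univ j),
        ← Finset.add_sum_erase Finset.univ (fun i => θ (Sum.inl ⟨⟨H, Nat.lt_succ_self H⟩,
          (k, i)⟩) * h i) (Finset.mem_univ j)]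
      have herase : ∑ i ∈ Finset.univ.erase j,
          Function.update θ p y (Sum.inl ⟨⟨H, Nat.lt_succ_self H⟩, (k, i)⟩) * h i
          = ∑ i ∈ Finset.univ.erase j, θ (Sum.inl ⟨⟨H, Nat.lt_succ_self H⟩, (k, i)⟩) * h i := by
        refine Finset.sum_congr rfl fun i hi => ?_
        rw [Function.update_of_ne]
        intro hip
        exact Finset.ne_of_mem_erase hi (by simpa [hp] using hip)
      rw [herase, ← hp, Function.update_self]
      ring
    have hbias : Function.update θ p y (Sum.inr ⟨⟨H, Nat.lt_succ_self H⟩, k⟩)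
        = θ (Sum.inr ⟨⟨H, Nat.lt_succ_self H⟩, k⟩) := Function.update_of_ne (by simp [hp]) _ _
    simp only [netOutput, preAct, hout, ← hh, hbias, hsum]
    ring
  have hd : HasDerivAt (fun y : ℝ => netOutput φ (Function.update θ p y) x t k) (h j) (θ p) := by
    simp only [key]
    simpa using ((hasDerivAt_id (θ p)).mul_const (h j)).add_const (netOutput φ θ x t k - θ p * h j)
  exact hd.deriv

/-- The largest eigenvalue of the Fisher information matrix dominates the average overlap of the
last hidden layer, through the block of the output weights. -/
lemma overlap_le_maxEigenvalue_fim (hT : 0 < T) (hC : 0 < n (H + 1)) (θ : ParamIdx n H → ℝ)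
    (x : Fin T → Fin (n 0) → ℝ) :
    n H * (∑ s, ∑ t, overlap φ θ x H (Nat.lt_succ_self H) s t) / (T : ℝ) ^ 2
      ≤ maxEigenvalue (fim φ θ x) := by
  have hT' : (0 : ℝ) < T := by positivity
  set h := hiddenOut φ θ x H (Nat.lt_succ_self H) with hh
  set k₀ : Fin (n (H + 1)) := ⟨0, hC⟩
  set e : Fin (n H) → ParamIdx n H := fun j => Sum.inl ⟨⟨H, Nat.lt_succ_self H⟩, (k₀, j)⟩ with he
  have hinj : Function.Injective e := weight_injective H (Nat.lt_succ_self H) k₀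
  -- The test direction: `v` is `w` on the weights into `k₀` and zero elsewhere.
  set w : Fin (n H) → ℝ := fun j => ∑ t, h t j with hw
  set v : ParamIdx n H → ℝ := Function.extend e w 0 with hv
  have hve (j : Fin (n H)) : v (e j) = w j := hinj.extend_apply _ _ _
  have hsum (g : ParamIdx n H → ℝ) : ∑ p, g p * v p = ∑ j, g (e j) * w j := by
    refine (Fintype.sum_of_injective e hinj _ _ (fun p hp => ?_) fun j => by rw [hve]).symm
    have : v p = 0 := Function.extend_apply' _ _ _ hp
    rw [this, mul_zero]
  set N : ℝ := ∑ j, w j * w j with hN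
  have hN0 : 0 ≤ N := Finset.sum_nonneg fun j _ => mul_self_nonneg _
  have hvv : v ⬝ᵥ v = N := by
    rw [dotProduct, hsum]
    simp only [hve, hN]
  have hNo : n H * (∑ s, ∑ t, overlap φ θ x H (Nat.lt_succ_self H) s t) = N := by
    rcases Nat.eq_zero_or_pos (n H) with h0 | h0
    · have : IsEmpty (Fin (n H)) := by rw [h0]; infer_instance
      simp [hN, h0]
    · have h0' : (n H : ℝ) ≠ 0 := by positivity
      have : ∀ s t, overlap φ θ x H (Nat.lt_succ_self H) s t = (∑ i, h s i * h t i) / n H :=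
        fun s t => rfl
      simp only [this, ← Finset.sum_div]
      rw [mul_div_cancel₀ _ h0']
      simp only [hN, hw, Finset.sum_mul_sum]
      rw [Finset.sum_comm]
      simp only [Finset.sum_comm (s := (Finset.univ : Finset (Fin (n H))))]
      exact Finset.sum_comm
  have hray : N ^ 2 / (T : ℝ) ^ 2 ≤ v ⬝ᵥ (fim φ θ x).mulVec v := by
    rw [dotProduct_fim_mulVec]
    have hk : (∑ t, (∑ p, outputPartial φ θ x t k₀ p * v p) ^ 2) / (T : ℝ)
        ≤ ∑ k, (∑ t, (∑ p, outputPartial φ θ x t k p * v p) ^ 2) / (T : ℝ) :=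
      Finset.single_le_sum (f := fun k => (∑ t, (∑ p, outputPartial φ θ x t k p * v p) ^ 2)
        / (T : ℝ)) (fun k _ => by positivity) (Finset.mem_univ k₀)
    refine le_trans ?_ hk
    have hrow (t : Fin T) : ∑ p, outputPartial φ θ x t k₀ p * v p = ∑ j, h t j * w j := by
      rw [hsum]
      exact Finset.sum_congr rfl fun j _ => by rw [he, outputPartial_last]
    simp only [hrow]
    have hNs : N = ∑ t, ∑ j, h t j * w j := by
      rw [Finset.sum_comm, hN]
      exact Finset.sum_congr rfl fun j _ => by rw [← Finset.sum_mul]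
    -- Cauchy–Schwarz over the samples: `N = ∑ₜ h(t)·w` gives `N² ≤ T ∑ₜ (h(t)·w)²`.
    have hcs := sq_sum_le_card_mul_sum_sq (s := (Finset.univ : Finset (Fin T)))
      (f := fun t => ∑ j, h t j * w j)
    rw [← hNs, Finset.card_univ, Fintype.card_fin] at hcs
    rw [div_le_div_iff₀ (by positivity) hT']
    nlinarith
  rw [hNo]
  have hmax := dotProduct_mulVec_le_maxEigenvalue (posSemidef_fim (φ := φ) θ x).1 v
  rw [hvv] at hmax
  rcases hN0.eq_or_lt with h0 | h0
  · rw [← h0, zero_div]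
    exact maxEigenvalue_nonneg (posSemidef_fim θ x)
  · have := hray.trans hmax
    rw [pow_two N, mul_div_right_comm] at this
    exact le_of_mul_le_mul_right this h0

end Fisher

/-- Sum of the entries of a matrix with constant diagonal and constant off-diagonal entries. -/
lemma sum_sum_exchangeable {T : ℕ} {Q : Fin T → Fin T → ℝ} {q r : ℝ} (hd : ∀ t, Q t t = q)
    (ho : ∀ s t, s ≠ t → Q s t = r) : ∑ s, ∑ t, Q s t = T * (q + (T - 1) * r) := by
  have hQ (s t : Fin T) : Q s t = (if s = t then q - r else 0) + r := by
    split_ifs with h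
    · subst h; rw [hd]; ring
    · rw [ho s t h]; ring
  simp only [hQ, Finset.sum_add_distrib, Finset.sum_ite_eq, Finset.mem_univ, if_true,
    Finset.sum_const, Finset.card_univ, Fintype.card_fin, nsmul_eq_mul]
  ring

/-- Convergence in probability of the overlaps of the last hidden layer bounds the largest
eigenvalue of the Fisher information matrix from below. -/
lemma tendsto_maxEigenvalue_lt {H T : ℕ} (hT : 0 < T) {σw σb : ℝ≥0} {φ : ℕ → ℝ → ℝ}
    {n : ℕ → ℕ → ℕ} (hC : ∀ M, 0 < n M (H + 1)) {α : ℝ}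
    (hα : Tendsto (fun M : ℕ => (n M H : ℝ) / (M : ℝ)) atTop (𝓝 α)) {Q : Fin T → Fin T → ℝ}
    (hQ : ∀ s t : Fin T, ∀ ε : ℝ, 0 < ε → Tendsto (fun M => ensemble (n M) H T σw σb
      {ω | ε ≤ |overlap φ ω.1 ω.2 H (Nat.lt_succ_self H) s t - Q s t|}) atTop (𝓝 0))
    {ε : ℝ} (hε : 0 < ε) :
    Tendsto (fun M : ℕ => ensemble (n M) H T σw σb
      {ω | maxEigenvalue (fim φ ω.1 ω.2) < (α * ((∑ s, ∑ t, Q s t) / (T : ℝ) ^ 2) - ε) * M})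
      atTop (𝓝 0) := by
  have hT' : (0 : ℝ) < T := by positivity
  set q := (∑ s, ∑ t, Q s t) / (T : ℝ) ^ 2 with hq
  -- Eventually `n M H / M < α + 1`, so an overlap error `δ` costs less than `ε / 2`; replacing the
  -- width ratio by `α` costs the other half. The second alternative is excluded later because the
  -- ratio is nonnegative.
  obtain ⟨δ, hδ, hδα⟩ : ∃ δ > 0, (α + 1) * δ < ε / 2 ∨ α + 1 ≤ 0 := by
    rcases le_or_gt (α + 1) 0 with h | h
    · exact ⟨1, one_pos, .inr h⟩
    · refine ⟨ε / (4 * (α + 1)), by positivity, .inl ?_⟩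
      field_simp
      linarith
  have hlim : Tendsto (fun M => ∑ s, ∑ t, ensemble (n M) H T σw σb
      {ω | δ ≤ |overlap φ ω.1 ω.2 H (Nat.lt_succ_self H) s t - Q s t|}) atTop (𝓝 0) := by
    have := tendsto_finsetSum (Finset.univ : Finset (Fin T)) fun s _ =>
      tendsto_finsetSum (Finset.univ : Finset (Fin T)) fun t _ => hQ s t δ hδ
    simpa using this
  refine tendsto_of_tendsto_of_tendsto_of_le_of_le' tendsto_const_nhds hlim
    (.of_forall fun _ => zero_le) ?_
  have hq_lim : Tendsto (fun M : ℕ => (n M H : ℝ) / (M : ℝ) * q) atTop (𝓝 (α * q)) :=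
    hα.mul_const q
  filter_upwards [eventually_gt_atTop 0, hα.eventually (gt_mem_nhds (lt_add_one α)),
    hq_lim.eventually (lt_mem_nhds (sub_lt_self (α * q) (half_pos hε)))] with M hM hM1 hM2
  have hM' : (0 : ℝ) < M := by positivity
  calc ensemble (n M) H T σw σb {ω | maxEigenvalue (fim φ ω.1 ω.2) < (α * q - ε) * M}
      ≤ ensemble (n M) H T σw σb (⋃ s, ⋃ t,
          {ω | δ ≤ |overlap φ ω.1 ω.2 H (Nat.lt_succ_self H) s t - Q s t|}) := by
        refine measure_mono fun ω hω => ?_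
        by_contra hbad
        have hclose (s t : Fin T) :
            Q s t - δ ≤ overlap φ ω.1 ω.2 H (Nat.lt_succ_self H) s t := by
          by_contra h
          refine hbad (Set.mem_iUnion₂.2 ⟨s, t, ?_⟩)
          rw [Set.mem_ofPred_eq, abs_sub_comm]
          exact le_trans (by linarith) (le_abs_self _)
        have hsum : ∑ s, ∑ t, Q s t - (T : ℝ) ^ 2 * δ
            ≤ ∑ s, ∑ t, overlap φ ω.1 ω.2 H (Nat.lt_succ_self H) s t := by
          have : ∑ s : Fin T, ∑ t : Fin T, (Q s t - δ) = ∑ s, ∑ t, Q s t - (T : ℝ) ^ 2 * δ := by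
            simp only [Finset.sum_sub_distrib, Finset.sum_const, Finset.card_univ,
              Fintype.card_fin, nsmul_eq_mul]
            ring
          rw [← this]
          exact Finset.sum_le_sum fun s _ => Finset.sum_le_sum fun t _ => hclose s t
        have hfim := overlap_le_maxEigenvalue_fim (φ := φ) hT (hC M) ω.1 ω.2
        have hlow : (n M H : ℝ) * (q - δ) ≤ maxEigenvalue (fim φ ω.1 ω.2) := by
          refine le_trans ?_ hfim
          rw [mul_div_assoc]
          refine mul_le_mul_of_nonneg_left ?_ (Nat.cast_nonneg _)
          rw [hq, le_div_iff₀ (by positivity), sub_mul, div_mul_cancel₀ _ (by positivity)]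
          linarith
        have hω' : maxEigenvalue (fim φ ω.1 ω.2) < (α * q - ε) * M := hω
        have hratio : (n M H : ℝ) = (n M H : ℝ) / M * M := by field_simp
        have h0 : 0 ≤ (n M H : ℝ) / M := by positivity
        have hα1 : (α + 1) * δ < ε / 2 := hδα.resolve_right (by linarith)
        have h1 : (n M H : ℝ) / M * δ ≤ (α + 1) * δ := mul_le_mul_of_nonneg_right hM1.le hδ.le
        have h2 : (α * q - ε) * M ≤ (n M H : ℝ) * (q - δ) := by
          rw [hratio, mul_right_comm]
          exact mul_le_mul_of_nonneg_right (by nlinarith) hM'.le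
        linarith
    _ ≤ ∑ s, ∑ t, ensemble (n M) H T σw σb
          {ω | δ ≤ |overlap φ ω.1 ω.2 H (Nat.lt_succ_self H) s t - Q s t|} :=
        (measure_iUnion_fintype_le _ _).trans
          (Finset.sum_le_sum fun s _ => measure_iUnion_fintype_le _ _)

end BNNet

theorem theorem3p4
    -- `H = L - 1 ≥ 1` hidden layers, `T ≥ 2` samples, weight scale `σw > 0`
    (H T : ℕ) (hH : 1 ≤ H) (hT : 2 ≤ T) (σw : ℝ≥0) (hσw : 0 < σw)
    -- activation functions of the hidden layers
    (φ : ℕ → ℝ → ℝ)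
    (hφ_deriv : ∀ l, 1 ≤ l → l ≤ H → BNNet.HasBoundedWeakDeriv (φ l))
    (hφ_nonneg : ∀ l, 1 ≤ l → l ≤ H → ∀ x, 0 ≤ φ l x)
    -- the inputs of the normalizations in layers `2, …, H` are not identically constant over the
    -- batch, so that the normalizations are defined
    (hφ_nonconst : ∀ l, 1 ≤ l → l < H →
      ∃ z : Fin T → ℝ, BNNet.IsNormalizedBatch z ∧ ∃ s t, φ l (z s) ≠ φ l (z t))
    -- the last activation is positive at some value that a normalized unit can take
    (hφ_pos : ∃ z : Fin T → ℝ, BNNet.IsNormalizedBatch z ∧ ∃ t, 0 < φ H (z t)) :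
    ∃ qt qst : ℝ,
      (∀ t, BNNet.orderParam φ σw T H t t = qt) ∧
      (∀ s t, s ≠ t → BNNet.orderParam φ σw T H s t = qst) ∧
      0 < qt ∧ 0 ≤ qst ∧
      ((∃ z : Fin T → ℝ, BNNet.IsNormalizedBatch z ∧
          ∃ s t, s ≠ t ∧ 0 < φ H (z s) ∧ 0 < φ H (z t)) → 0 < qst) ∧
      -- bias scale, number of outputs, width coefficients, and widths `n M l ∼ α l * M`
      ∀ (σb : ℝ≥0) (C : ℕ) (_ : 1 ≤ C) (α : ℕ → ℝ) (_ : ∀ l, l ≤ H → 0 < α l)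
        (n : ℕ → ℕ → ℕ) (_ : ∀ M, n M (H + 1) = C)
        (_ : ∀ l, l ≤ H → Tendsto (fun M : ℕ => (n M l : ℝ) / (M : ℝ)) atTop (𝓝 (α l))),
        (∀ s t : Fin T, ∀ ε : ℝ, 0 < ε →
          Tendsto (fun M : ℕ => BNNet.ensemble (n M) H T σw σb
            {ω | ε ≤ |BNNet.overlap φ ω.1 ω.2 H (Nat.lt_succ_self H) s t
                      - BNNet.orderParam φ σw T H s t|}) atTop (𝓝 0)) ∧
        (∀ ε : ℝ, 0 < ε →
          Tendsto (fun M : ℕ => BNNet.ensemble (n M) H T σw σb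
            {ω | BNNet.maxEigenvalue (BNNet.fim φ ω.1 ω.2)
                  < (α H * (((T : ℝ) - 1) / T * qst + qt / T) - ε) * M}) atTop (𝓝 0)) ∧
        (∃ c : ℝ, 0 < c ∧
          Tendsto (fun M : ℕ => BNNet.ensemble (n M) H T σw σb
            {ω | BNNet.maxEigenvalue (BNNet.fim φ ω.1 ω.2) < c * M}) atTop (𝓝 0)) := by
  have hT0 : 0 < T := by omega
  have hT0' : (0 : ℝ) < T := by positivity
  have hT1 : (1 : ℝ) ≤ (T : ℝ) - 1 := by
    have : (2 : ℝ) ≤ T := by exact_mod_cast hT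
    linarith
  have hφ (l : ℕ) (h1 : 1 ≤ l) (h2 : l ≤ H) : Continuous (φ l) := (hφ_deriv l h1 h2).1
  -- Nondegeneracy is needed only for the covariance feeding the last hidden layer, at index `K`;
  -- that layer's own order parameter may be degenerate.
  obtain ⟨K, rfl⟩ : ∃ K, H = K + 1 := ⟨H - 1, by omega⟩
  obtain ⟨a, b, ha, hb, hQ⟩ := BNNet.exists_orderParam_eq (σw := σw) hT hσw hφ hφ_nonneg
    hφ_nonconst K (by omega)
  have hc := hφ (K + 1) hH le_rfl
  have h0 := hφ_nonneg (K + 1) hH le_rfl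
  have heq := BNNet.orderParam_succ_eq hT0 hσw hc ha hb hQ
  obtain ⟨qt, qst, hqr⟩ := BNNet.exists_integral_pairAct_eq hT (φ (K + 1))
  have hdiag (t : Fin T) : BNNet.orderParam φ σw T (K + 1) t t = qt := by rw [heq, hqr, if_pos rfl]
  have hoff (s t : Fin T) (hst : s ≠ t) : BNNet.orderParam φ σw T (K + 1) s t = qst := by
    rw [heq, hqr, if_neg hst]
  have hqt : 0 < qt := by
    obtain ⟨z, hz, t, ht⟩ := hφ_pos
    have := BNNet.integral_pairAct_pos hT0 hc h0 hz ht ht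
    rwa [hqr, if_pos rfl] at this
  have hqst : 0 ≤ qst := by
    have := BNNet.integral_pairAct_nonneg h0 (⟨0, by omega⟩ : Fin T) ⟨1, by omega⟩
    rwa [hqr, if_neg (by simp)] at this
  refine ⟨qt, qst, hdiag, hoff, hqt, hqst, ?_, ?_⟩
  · rintro ⟨z, hz, s, t, hst, hs, ht⟩
    have := BNNet.integral_pairAct_pos hT0 hc h0 hz hs ht
    rwa [hqr, if_neg hst] at this
  intro σb C hC α hα n hnC hn
  have hover (s t : Fin T) (ε : ℝ) (hε : 0 < ε) :=
    BNNet.tendsto_overlap hT hσw hφ hφ_nonneg hφ_nonconst σb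
      (fun l hl => BNNet.tendsto_width (hα l hl) (hn l hl)) (K + 1) (Nat.lt_succ_self _) s t hε
  have hsum : (∑ s, ∑ t, BNNet.orderParam φ σw T (K + 1) s t) / (T : ℝ) ^ 2
      = ((T : ℝ) - 1) / T * qst + qt / T := by
    rw [BNNet.sum_sum_exchangeable hdiag hoff]
    field_simp
    ring
  have hmax (ε : ℝ) (hε : 0 < ε) := BNNet.tendsto_maxEigenvalue_lt hT0
    (fun M => by rw [hnC M]; exact hC) (hn (K + 1) le_rfl) hover hε
  simp only [hsum] at hmax
  refine ⟨hover, hmax, ?_⟩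
  have hpos : 0 < α (K + 1) * (((T : ℝ) - 1) / T * qst + qt / T) := by
    have := hα (K + 1) le_rfl
    positivity
  -- Half of the limiting constant is spent as `ε` and the other half remains as `c`.
  refine ⟨α (K + 1) * (((T : ℝ) - 1) / T * qst + qt / T) / 2, by positivity, ?_⟩
  convert hmax _ (half_pos hpos) using 6
  ring
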